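/- **Setting.** Let $S^3\subset\mathbb C^2$ be the unit sphere, parametrized by $(x,y,z)\in[0,1]\times\mathbb R/\mathbb Z\times\mathbb R/\mathbb Z\mapsto(\sqrt x\,e^{2\pi i y},\sqrt{1-x}\,e^{2\pi i z})$, so that $y$ is collapsed on the core circle $\{x=0\}$ and $z$ on the core circle $\{x=1\}$. Let $\zeta_1=\ker\alpha_1$ be the contact structure on $S^3$ defined by the smooth 1-form $\alpha_1$ that equals $\cos\left(\tfrac32\pi x\right)dz-\sin\left(\tfrac32\pi x\right)dy$ where $0<x<1$. The plane field $\zeta_1$ is oriented by $d\alpha_1$. A parallelization of $\zeta_1$ is a continuous frame $(e_1,e_2)$ of $\zeta_1$ on all of $S^3$, positive for this orientation. For an oriented Legendrian knot $K$ in $(S^3,\zeta_1)$ (a smoothly embedded circle tangent to $\zeta_1$), the rotation number $\mathrm{rot}(K)\in\mathbb Z$ with respect to a parallelization is the number of revolutions, counted with sign, that the tangent vector of $K$ makes with respect to $(e_1,e_2)$ as $K$ is traversed once. Let $K$ be in general position: disjoint from the two core circles, and such that the only singular points of its front on the torus, that is of its projection $(x,y,z)\mapsto(y,z)$ to $T^2=\mathbb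 R^2/\mathbb Z^2$, are ordinary (semicubical) cusps. Let $(\alpha,\beta)\in\pi_1(T^2)=\mathbb Z^2$ be the homotopy class of the front, where $(1,0)$ is the loop along which $y$ increases from $0$ to $1$ (left to right) and $(0,1)$ the loop along which $z$ increases from $0$ to $1$ (upwards). Let $\nu=\left(-\sin\left(\tfrac32\pi x\right),\cos\left(\tfrac32\pi x\right)\right)$ be the normal vector field along the front in the $(y,z)$-plane given by the coorientation of $\zeta_1$ that points up near $\{x=0\}$. A cusp is *ascending* if it is traversed in the direction of $\nu$ and *descending* if it is traversed in the direction opposite to $\nu$. A cusp is called *positive* if it is descending and *negative* if it is ascending. Let $\mathrm{cusp}_+$ and $\mathrm{cusp}_-$ be the numbers of positive and of negative cusps of the front. **Proposition.** The contact structure $\zeta_1$ admits a parallelization, and with respect to every parallelization of $\zeta_1$ (positive for the above orientation), every oriented Legendrian knot $K$ in general position satisfies $$\mathrm{rot}(K)=\tfrac12\left(\mathrm{cusp}_+-\mathrm{cusp}_-\right)-\alpha-\beta .$$ -/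

import Mathlib

open scoped ContDiff

namespace TorusFront

noncomputable section

/-- The ambient real vector space `ℂ²` of the three-sphere. -/
abbrev CC : Type := EuclideanSpace ℂ (Fin 2)

/-- The three-sphere, as the unit sphere of `ℂ²`. -/
abbrev S3 : Set CC := Metric.sphere (0 : CC) 1

/-- The coordinates `(x, y, z)` on the three-sphere: the map from the cube `[0,1]³` onto `S³`,
`(x, y, z) ↦ (√x exp(2πiy), √(1-x) exp(2πiz))`.  Its point identifications are those of opposite
points on the faces `z = 0, 1` and on the faces `y = 0, 1`, the collapse of every segment in the
`y`-direction on the front face `x = 0`, and the collapse of every segment in the `z`-direction on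
the back face `x = 1`. -/
def cubeMap (x y z : ℝ) : CC :=
  !₂[(√x : ℂ) * Complex.exp ((2 * Real.pi * y : ℝ) * Complex.I),
     (√(1 - x) : ℂ) * Complex.exp ((2 * Real.pi * z : ℝ) * Complex.I)]

/-- The coordinate `x` of a point of the three-sphere. -/
def xCoord (p : CC) : ℝ := ‖p 0‖ ^ 2

/-- The smooth contact form on `S³` which in the cube coordinates is
`cos (3πx/2) dz - sin (3πx/2) dy` (this is proved in `contactForm_cubeMap` below).  The formula in
terms of `sinc t = sin t / t` makes sense on the core circles `x = 0` and `x = 1` too; it defines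
a one-form on all of `ℂ²`, of which only the restriction to `S³` matters. -/
def contactForm (p v : CC) : ℝ :=
  -(3 / 4) *
    (Real.sinc (3 * Real.pi / 2 * ‖p 0‖ ^ 2) * ((starRingEnd ℂ) (p 0) * v 0).im +
      Real.sinc (3 * Real.pi / 2 * ‖p 1‖ ^ 2) * ((starRingEnd ℂ) (p 1) * v 1).im)

/-- The exterior derivative of `contactForm`. -/
def dContactForm (p u v : CC) : ℝ :=
  fderiv ℝ (fun q => contactForm q v) p u - fderiv ℝ (fun q => contactForm q u) p v

/-- The plane of the contact structure `ζ₁` at a point `p` of `S³`: the vectors tangent to `S³`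
at `p` that are annihilated by the contact form. -/
def contactPlane (p : CC) : Set CC :=
  {v | inner ℝ p v = 0 ∧ contactForm p v = 0}

/-- A positively oriented parallelization of `ζ₁`: a global continuous frame of the plane field,
positive for the orientation given by the exterior derivative of the contact form. -/
structure Parallelization where
  e₁ : S3 → CC
  e₂ : S3 → CC
  continuous₁ : Continuous e₁
  continuous₂ : Continuous e₂
  mem₁ : ∀ p : S3, e₁ p ∈ contactPlane p
  mem₂ : ∀ p : S3, e₂ p ∈ contactPlane p
  linearIndependent : ∀ p : S3, LinearIndependent ℝ ![e₁ p, e₂ p]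
  positive : ∀ p : S3, 0 < dContactForm p (e₁ p) (e₂ p)

/-- An (oriented, parametrized) Legendrian knot in `(S³, ζ₁)`: a smooth embedding of the circle
`ℝ / ℤ`, written as a `1`-periodic map on `ℝ`, tangent to the contact planes. -/
structure LegendrianKnot where
  toFun : ℝ → CC
  mem_sphere : ∀ t, toFun t ∈ S3
  smooth : ContDiff ℝ ∞ toFun
  periodic : Function.Periodic toFun 1
  injOn : Set.InjOn toFun (Set.Ico 0 1)
  immersion : ∀ t, deriv toFun t ≠ 0
  legendrian : ∀ t, deriv toFun t ∈ contactPlane (toFun t)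

/-- The projection of `S³` minus the core circles `x = 0` and `x = 1` to the torus, in coordinates
`(x, y, z) ↦ (y, z)`.  (The value on the core circles is irrelevant.) -/
def torusProj (p : CC) : UnitAddCircle × UnitAddCircle :=
  (((p 0).arg / (2 * Real.pi) : ℝ), ((p 1).arg / (2 * Real.pi) : ℝ))

namespace LegendrianKnot

/-- The front diagram of a knot on the torus. -/
def front (K : LegendrianKnot) (t : ℝ) : UnitAddCircle × UnitAddCircle := torusProj (K.toFun t)

/-- `f` is a lift of the front diagram to the universal covering `ℝ²` of the torus; its two
coordinates are `y` (horizontal, left to right) and `z` (vertical, upwards). -/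
def IsFrontLift (K : LegendrianKnot) (f : ℝ → ℝ × ℝ) : Prop :=
  Continuous f ∧ ∀ t, K.front t = (((f t).1 : UnitAddCircle), ((f t).2 : UnitAddCircle))

/-- The knot is in general position with respect to the projection to the torus: it is disjoint
from the two core circles, and the only singularities of its front are ordinary (semicubical)
cusps, i.e. wherever the velocity of the front vanishes, its second and third derivatives are
linearly independent. -/
def InGeneralPosition (K : LegendrianKnot) : Prop :=
  (∀ t, K.toFun t 0 ≠ 0 ∧ K.toFun t 1 ≠ 0) ∧
    ∀ f, K.IsFrontLift f → ∀ t, deriv f t = 0 →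
      LinearIndependent ℝ ![iteratedDeriv 2 f t, iteratedDeriv 3 f t]

/-- The front diagram has the homotopy class `(a, b) ∈ π₁(T²) = ℤ²`. -/
def HasFrontClass (K : LegendrianKnot) (a b : ℤ) : Prop :=
  ∃ f, K.IsFrontLift f ∧ f 1 = f 0 + ((a : ℝ), (b : ℝ))

/-- The height of a point `w` of the plane in the direction of the normal vector
`ν = (-sin (3πx/2), cos (3πx/2))` to the front at the parameter `t`, given by the coorientation of
`ζ₁` that points up near the front face `x = 0`. -/
def height (K : LegendrianKnot) (t : ℝ) (w : ℝ × ℝ) : ℝ :=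
  -Real.sin (3 * Real.pi / 2 * xCoord (K.toFun t)) * w.1 +
    Real.cos (3 * Real.pi / 2 * xCoord (K.toFun t)) * w.2

/-- There is a cusp of the front at the parameter `t`, and it is traversed in the direction of
`ν`. -/
def IsAscendingCusp (K : LegendrianKnot) (t : ℝ) : Prop :=
  ∃ f, K.IsFrontLift f ∧ deriv f t = 0 ∧
    ∃ δ > 0, StrictMonoOn (fun s => K.height t (f s)) (Set.Ioo (t - δ) (t + δ))

/-- There is a cusp of the front at the parameter `t`, and it is traversed in the direction
opposite to `ν`. -/
def IsDescendingCusp (K : LegendrianKnot) (t : ℝ) : Prop :=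
  ∃ f, K.IsFrontLift f ∧ deriv f t = 0 ∧
    ∃ δ > 0, StrictAntiOn (fun s => K.height t (f s)) (Set.Ioo (t - δ) (t + δ))

/-- The number of positive cusps of the front, which are the descending ones. -/
def cuspPos (K : LegendrianKnot) : ℕ := {t ∈ Set.Ico (0 : ℝ) 1 | K.IsDescendingCusp t}.ncard

/-- The number of negative cusps of the front, which are the ascending ones. -/
def cuspNeg (K : LegendrianKnot) : ℕ := {t ∈ Set.Ico (0 : ℝ) 1 | K.IsAscendingCusp t}.ncard

/-- The rotation number of `K` with respect to `P` is `r`: the tangent vector of `K`, expressed in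
the frame `P`, makes `r` revolutions (counted with sign) as `K` is traversed once. -/
def HasRotation (K : LegendrianKnot) (P : Parallelization) (r : ℤ) : Prop :=
  ∃ φ ρ : ℝ → ℝ, Continuous φ ∧ (∀ t, 0 < ρ t) ∧
    (∀ t, deriv K.toFun t =
      ρ t • (Real.cos (φ t) • P.e₁ ⟨K.toFun t, K.mem_sphere t⟩ +
        Real.sin (φ t) • P.e₂ ⟨K.toFun t, K.mem_sphere t⟩)) ∧
    φ 1 = φ 0 + 2 * Real.pi * r

end LegendrianKnot

theorem cubeMap_mem {x : ℝ} (hx : x ∈ Set.Icc (0 : ℝ) 1) (y z : ℝ) : cubeMap x y z ∈ S3 := by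
  have h1 : 0 ≤ 1 - x := by linarith [hx.2]
  rw [mem_sphere_zero_iff_norm, EuclideanSpace.norm_eq]
  simp [cubeMap, Fin.sum_univ_two, Complex.norm_exp, Real.sq_sqrt hx.1, Real.sq_sqrt h1]

theorem hasDerivAt_polar {x y : ℝ → ℝ} {x' y' t : ℝ} (hx : HasDerivAt x x' t)
    (hy : HasDerivAt y y' t) (h0 : 0 < x t) :
    HasDerivAt (fun s => (√(x s) : ℂ) * Complex.exp ((2 * Real.pi * y s : ℝ) * Complex.I))
      (((x' / (2 * √(x t)) : ℝ) + (√(x t) : ℝ) * ((2 * Real.pi * y' : ℝ) * Complex.I)) *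
        Complex.exp ((2 * Real.pi * y t : ℝ) * Complex.I)) t := by
  have h := ((hx.sqrt h0.ne').ofReal_comp).mul
    (((hy.const_mul (2 * Real.pi)).ofReal_comp.mul_const Complex.I).cexp)
  refine h.congr_deriv ?_
  push_cast
  ring

theorem polar_im {x : ℝ} (h0 : 0 < x) (a b c : ℝ) :
    ((starRingEnd ℂ) ((√x : ℂ) * Complex.exp ((c : ℝ) * Complex.I)) *
      (((a : ℝ) + (√x : ℝ) * ((b : ℝ) * Complex.I)) * Complex.exp ((c : ℝ) * Complex.I))).im
      = x * b := by
  have h : (starRingEnd ℂ) (Complex.exp ((c : ℝ) * Complex.I)) * Complex.exp ((c : ℝ) * Complex.I)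
      = 1 := by
    rw [← Complex.exp_conj, ← Complex.exp_add]
    simp
  have h2 : (√x : ℂ) * (√x : ℂ) = (x : ℂ) := by
    rw [← Complex.ofReal_mul, Real.mul_self_sqrt h0.le]
  have h3 : (starRingEnd ℂ) ((√x : ℂ) * Complex.exp ((c : ℝ) * Complex.I)) *
      (((a : ℝ) + (√x : ℝ) * ((b : ℝ) * Complex.I)) * Complex.exp ((c : ℝ) * Complex.I))
      = ((√x * a : ℝ) : ℂ) + ((x * b : ℝ) : ℂ) * Complex.I := by
    rw [map_mul, Complex.conj_ofReal]
    push_cast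
    linear_combination ((√x : ℂ) * a + √x * √x * b * Complex.I) * h + (b * Complex.I) * h2
  rw [h3]
  simp

/-- In the cube coordinates the contact form is `cos (3πx/2) dz - sin (3πx/2) dy`: this is its value
on the velocity of a curve. -/
theorem contactForm_cubeMap {x y z : ℝ → ℝ} {x' y' z' t : ℝ} (hx : HasDerivAt x x' t)
    (hy : HasDerivAt y y' t) (hz : HasDerivAt z z' t) (h0 : 0 < x t) (h1 : x t < 1) :
    contactForm (cubeMap (x t) (y t) (z t)) (deriv (fun s => cubeMap (x s) (y s) (z s)) t) =
      Real.cos (3 * Real.pi / 2 * x t) * z' - Real.sin (3 * Real.pi / 2 * x t) * y' := by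
  have h1' : 0 < 1 - x t := by linarith
  have hd : HasDerivAt (fun s => cubeMap (x s) (y s) (z s))
      (WithLp.toLp 2 ![
        ((x' / (2 * √(x t)) : ℝ) + (√(x t) : ℝ) * ((2 * Real.pi * y' : ℝ) * Complex.I)) *
          Complex.exp ((2 * Real.pi * y t : ℝ) * Complex.I),
        ((-x' / (2 * √(1 - x t)) : ℝ) + (√(1 - x t) : ℝ) * ((2 * Real.pi * z' : ℝ) * Complex.I)) *
          Complex.exp ((2 * Real.pi * z t : ℝ) * Complex.I)]) t := by
    have hp : HasDerivAt (fun s => ![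
        (√(x s) : ℂ) * Complex.exp ((2 * Real.pi * y s : ℝ) * Complex.I),
        (√(1 - x s) : ℂ) * Complex.exp ((2 * Real.pi * z s : ℝ) * Complex.I)]) ![
        ((x' / (2 * √(x t)) : ℝ) + (√(x t) : ℝ) * ((2 * Real.pi * y' : ℝ) * Complex.I)) *
          Complex.exp ((2 * Real.pi * y t : ℝ) * Complex.I),
        ((-x' / (2 * √(1 - x t)) : ℝ) + (√(1 - x t) : ℝ) * ((2 * Real.pi * z' : ℝ) * Complex.I)) *
          Complex.exp ((2 * Real.pi * z t : ℝ) * Complex.I)] t := by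
      rw [hasDerivAt_pi]
      intro i
      fin_cases i
      · exact hasDerivAt_polar hx hy h0
      · exact hasDerivAt_polar (x := fun s => 1 - x s) (hx.const_sub 1) hz h1'
    exact ((PiLp.continuousLinearEquiv 2 ℝ (fun _ : Fin 2 => ℂ)).symm.hasFDerivAt).comp_hasDerivAt
      t hp
  have e0 := polar_im h0 (x' / (2 * √(x t))) (2 * Real.pi * y') (2 * Real.pi * y t)
  have e1 := polar_im h1' (-x' / (2 * √(1 - x t))) (2 * Real.pi * z') (2 * Real.pi * z t)
  have n0 : ‖(√(x t) : ℂ) * Complex.exp ((2 * Real.pi * y t : ℝ) * Complex.I)‖ ^ 2 = x t := by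
    rw [norm_mul, Complex.norm_exp_ofReal_mul_I]
    simp [Real.sq_sqrt h0.le]
  have n1 : ‖(√(1 - x t) : ℂ) * Complex.exp ((2 * Real.pi * z t : ℝ) * Complex.I)‖ ^ 2
      = 1 - x t := by
    rw [norm_mul, Complex.norm_exp_ofReal_mul_I]
    simp [Real.sq_sqrt h1'.le]
  rw [hd.deriv]
  unfold contactForm cubeMap
  simp only [Matrix.cons_val_zero, Matrix.cons_val_one]
  rw [e0, e1, n0, n1, Real.sinc_of_ne_zero (by positivity), Real.sinc_of_ne_zero (by positivity)]
  have hs : Real.sin (3 * Real.pi / 2 * (1 - x t)) = -Real.cos (3 * Real.pi / 2 * x t) := by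
    have : 3 * Real.pi / 2 * (1 - x t) = Real.pi + (Real.pi / 2 - 3 * Real.pi / 2 * x t) := by ring
    rw [this, Real.sin_add, Real.sin_pi_div_two_sub]
    simp
  rw [hs]
  have hpi := Real.pi_ne_zero
  have := h0.ne'
  have := h1'.ne'
  field_simp
  ring

end

end TorusFront

namespace TorusFront

noncomputable section

open Filter Topology

/-! Write θ = 3πx/2. Off the core circles `ζ₁` is spanned by ∂_x and W = -(cos θ ∂_y + sin θ ∂_z),
and a Legendrian velocity is x'·∂_x + b·W, where b is the signed speed of the front (`frontSpeed`).
After rescaling by positive factors, the complex number x' + ib is therefore the velocity in this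
frame. The frame does not extend over the cores, but rotated by exp(2πi(y+z)) it does: at x = 0 the
angle y cancels because cos 0 = 1, and at x = 1 the angle z cancels because sin(3π/2) = -1. This is
`frameMap`, which gives the parallelization. By `frameCoord_eq`, the winding number of x' + ib
exceeds that of the velocity in the global frame by α + β.

The winding number of x' + ib is half the signed number of its crossings of the real axis
(`two_mul_turns_eq`). These are the zeros of b, that is the cusps. General position gives b' ≠ 0
there, and immersion gives x' ≠ 0, so each crossing is a half-turn of sign b'x'. At a cusp at
parameter t, the derivative of the height along ν(t) is -b(s) sin(θ(s) - θ(t)), whose sign near t is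
that of -b'x'. Hence descending cusps are exactly the positive half-turns, and 2(rot + α + β) =
cusp₊ - cusp₋.

Any other positive parallelization gives the same number (`HasRotation.frameCoord_angle`). The knot
misses a point of S³, whose complement is contractible, so the first frame vector has no winding
along the knot relative to the global frame. The second stays on the positive side of the first and
adds no turns. -/

/-! ### The contact form and its exterior derivative -/

theorem differentiable_sinc : Differentiable ℝ Real.sinc := by
  intro x
  rw [Real.sinc_eq_dslope]
  by_cases hx : x = 0
  · subst hx
    obtain ⟨p, hp⟩ := Real.analyticAt_sin (x := 0)
    exact hp.has_fpower_series_dslope_fslope.analyticAt.differentiableAt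
  · exact (differentiableAt_dslope_of_ne hx).2 Real.differentiableAt_sin

/-- This is the derivative of t sinc t = sin t. It turns the `sinc` terms of the exterior derivative
into cosines. -/
theorem deriv_sinc_mul_add_sinc (k x : ℝ) :
    k * deriv Real.sinc (k * x) * x + Real.sinc (k * x) = Real.cos (k * x) := by
  have h1 : HasDerivAt (fun t => t * Real.sinc t)
      (1 * Real.sinc (k * x) + k * x * deriv Real.sinc (k * x)) (k * x) :=
    (hasDerivAt_id _).mul (differentiable_sinc _).hasDerivAt
  have h2 : (fun t => t * Real.sinc t) = Real.sin := by
    ext t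
    by_cases ht : t = 0
    · simp [ht]
    · rw [Real.sinc_of_ne_zero ht]; field_simp
  rw [h2] at h1
  have := h1.unique (Real.hasDerivAt_sin _)
  linarith

theorem inner_CC (p v : CC) :
    inner ℝ p v = ((starRingEnd ℂ) (p 0) * v 0).re + ((starRingEnd ℂ) (p 1) * v 1).re := by
  simp [PiLp.inner_apply, Fin.sum_univ_two, Complex.inner]
  ring

theorem mem_S3_iff (p : CC) : p ∈ S3 ↔ ‖p 0‖ ^ 2 + ‖p 1‖ ^ 2 = 1 := by
  rw [mem_sphere_zero_iff_norm, EuclideanSpace.norm_eq, Fin.sum_univ_two, Real.sqrt_eq_one]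

/-- One of the two summands of the contact form, as a function on `ℂ`. -/
def sincForm (a w : ℂ) : ℝ :=
  Real.sinc (3 * Real.pi / 2 * ‖a‖ ^ 2) * ((starRingEnd ℂ) a * w).im

theorem hasFDerivAt_sincForm (a u w : ℂ) :
    ∃ L : ℂ →L[ℝ] ℝ, HasFDerivAt (fun q => sincForm q w) L a ∧
      L u = 3 * Real.pi / 2 * deriv Real.sinc (3 * Real.pi / 2 * ‖a‖ ^ 2) *
        (2 * ((starRingEnd ℂ) a * u).re) * ((starRingEnd ℂ) a * w).im +
        Real.sinc (3 * Real.pi / 2 * ‖a‖ ^ 2) * ((starRingEnd ℂ) u * w).im := by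
  have h1 : HasFDerivAt (fun q : ℂ => 3 * Real.pi / 2 * ‖q‖ ^ 2) _ a :=
    ((hasStrictFDerivAt_norm_sq a).hasFDerivAt).const_mul (3 * Real.pi / 2)
  have h2 := (differentiable_sinc (3 * Real.pi / 2 * ‖a‖ ^ 2)).hasDerivAt.comp_hasFDerivAt a h1
  have h3 : HasFDerivAt (fun q : ℂ => ((starRingEnd ℂ) q * w).im) _ a :=
    Complex.imCLM.hasFDerivAt.comp a
      ((Complex.conjCLE.toContinuousLinearMap.hasFDerivAt (x := a)).mul_const w)
  refine ⟨_, h2.mul h3, ?_⟩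
  simp [Complex.inner]
  ring

theorem fderiv_contactForm (p u w : CC) :
    fderiv ℝ (fun q => contactForm q w) p u =
      -(3 / 4) * ((3 * Real.pi / 2 * deriv Real.sinc (3 * Real.pi / 2 * ‖p 0‖ ^ 2) *
        (2 * ((starRingEnd ℂ) (p 0) * u 0).re) * ((starRingEnd ℂ) (p 0) * w 0).im +
        Real.sinc (3 * Real.pi / 2 * ‖p 0‖ ^ 2) * ((starRingEnd ℂ) (u 0) * w 0).im) +
        (3 * Real.pi / 2 * deriv Real.sinc (3 * Real.pi / 2 * ‖p 1‖ ^ 2) *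
        (2 * ((starRingEnd ℂ) (p 1) * u 1).re) * ((starRingEnd ℂ) (p 1) * w 1).im +
        Real.sinc (3 * Real.pi / 2 * ‖p 1‖ ^ 2) * ((starRingEnd ℂ) (u 1) * w 1).im)) := by
  obtain ⟨L0, h0, e0⟩ := hasFDerivAt_sincForm (p 0) (u 0) (w 0)
  obtain ⟨L1, h1, e1⟩ := hasFDerivAt_sincForm (p 1) (u 1) (w 1)
  have hp (i : Fin 2) : HasFDerivAt (fun q : CC => q i)
      (PiLp.proj 2 (𝕜 := ℝ) (fun _ : Fin 2 => ℂ) i) p :=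
    (PiLp.proj 2 (𝕜 := ℝ) (fun _ : Fin 2 => ℂ) i).hasFDerivAt
  have h := ((HasFDerivAt.comp p h0 (hp 0)).add (HasFDerivAt.comp p h1 (hp 1))).const_mul
    (-(3 / 4 : ℝ))
  have h' : HasFDerivAt (fun q => contactForm q w) _ p := h
  rw [h'.fderiv, ← e0, ← e1]
  simp
  ring

theorem dContactForm_eq (p u v : CC) :
    dContactForm p u v = -(3 / 2) *
      (Real.cos (3 * Real.pi / 2 * ‖p 0‖ ^ 2) * ((starRingEnd ℂ) (u 0) * v 0).im +
        Real.cos (3 * Real.pi / 2 * ‖p 1‖ ^ 2) * ((starRingEnd ℂ) (u 1) * v 1).im) := by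
  rw [dContactForm, fderiv_contactForm, fderiv_contactForm,
    ← deriv_sinc_mul_add_sinc (3 * Real.pi / 2) (‖p 0‖ ^ 2),
    ← deriv_sinc_mul_add_sinc (3 * Real.pi / 2) (‖p 1‖ ^ 2)]
  -- Antisymmetrizing the term in which `sinc` is differentiated produces ‖a‖² times the area form.
  -- It can then be merged with the undifferentiated `sinc` term.
  have key (a u v : ℂ) : ((starRingEnd ℂ) a * u).re * ((starRingEnd ℂ) a * v).im -
      ((starRingEnd ℂ) a * v).re * ((starRingEnd ℂ) a * u).im =
      ‖a‖ ^ 2 * ((starRingEnd ℂ) u * v).im := by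
    rw [Complex.sq_norm, Complex.normSq_apply]
    simp
    ring
  have anti (u v : ℂ) : ((starRingEnd ℂ) v * u).im = -((starRingEnd ℂ) u * v).im := by
    simp; ring
  rw [anti (u 0) (v 0), anti (u 1) (v 1)]
  linear_combination (-(3 / 4) * (3 * Real.pi / 2 * deriv Real.sinc (3 * Real.pi / 2 * ‖p 0‖ ^ 2)
    * 2)) * key (p 0) (u 0) (v 0) + (-(3 / 4) * (3 * Real.pi / 2 *
    deriv Real.sinc (3 * Real.pi / 2 * ‖p 1‖ ^ 2) * 2)) * key (p 1) (u 1) (v 1)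

/-- The smooth function which is `sin (3πx/2) / x` for `x ≠ 0`. -/
def sinQuot (p : CC) : ℝ := 3 * Real.pi / 2 * Real.sinc (3 * Real.pi / 2 * ‖p 0‖ ^ 2)

/-- The smooth function which on the sphere is `cos (3πx/2) / (1 - x)` for `x ≠ 1`. -/
def cosQuot (p : CC) : ℝ := -(3 * Real.pi / 2 * Real.sinc (3 * Real.pi / 2 * ‖p 1‖ ^ 2))

theorem mul_sinc (t : ℝ) : t * Real.sinc t = Real.sin t := by
  by_cases ht : t = 0
  · simp [ht]
  · rw [Real.sinc_of_ne_zero ht]; field_simp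

theorem sin_three_halves_pi_sub (x : ℝ) :
    Real.sin (3 * Real.pi / 2 * (1 - x)) = -Real.cos (3 * Real.pi / 2 * x) := by
  have : 3 * Real.pi / 2 * (1 - x) = Real.pi + (Real.pi / 2 - 3 * Real.pi / 2 * x) := by ring
  rw [this, Real.sin_add, Real.sin_pi_div_two_sub]
  simp

theorem cos_three_halves_pi_sub (x : ℝ) :
    Real.cos (3 * Real.pi / 2 * (1 - x)) = -Real.sin (3 * Real.pi / 2 * x) := by
  have : 3 * Real.pi / 2 * (1 - x) = Real.pi + (Real.pi / 2 - 3 * Real.pi / 2 * x) := by ring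
  rw [this, Real.cos_add, Real.cos_pi_div_two_sub]
  simp

theorem sinQuot_mul (p : CC) : sinQuot p * ‖p 0‖ ^ 2 = Real.sin (3 * Real.pi / 2 * ‖p 0‖ ^ 2) := by
  rw [← mul_sinc, sinQuot]; ring

theorem cosQuot_mul {p : CC} (hp : p ∈ S3) :
    cosQuot p * ‖p 1‖ ^ 2 = Real.cos (3 * Real.pi / 2 * ‖p 0‖ ^ 2) := by
  have h := (mem_S3_iff p).1 hp
  have : ‖p 1‖ ^ 2 = 1 - ‖p 0‖ ^ 2 := by linarith
  rw [← neg_neg (Real.cos _), ← sin_three_halves_pi_sub, ← this, ← mul_sinc, cosQuot]; ring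

theorem sinQuot_eq_of_zero {p : CC} (hp : p ∈ S3) (h : p 1 = 0) : sinQuot p = -1 := by
  have h1 := (mem_S3_iff p).1 hp
  have h2 := sinQuot_mul p
  rw [h] at h1
  simp only [norm_zero, ne_eq, OfNat.ofNat_ne_zero, not_false_eq_true, zero_pow, add_zero] at h1
  have := cos_three_halves_pi_sub 1
  rw [h1] at h2
  simp at this h2
  linarith

theorem cosQuot_eq_of_zero {p : CC} (hp : p ∈ S3) (h : p 0 = 0) : cosQuot p = 1 := by
  have h1 := (mem_S3_iff p).1 hp
  have h2 := cosQuot_mul hp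
  rw [h] at h1 h2
  simp at h1 h2
  rcases h1 with h1 | h1 <;> simpa [h1] using h2

/-- The two quotients have no singularity on the cores, so this form of α, unlike the one with dy
and dz, can be used at every point of the sphere. -/
theorem contactForm_eq_quot (p v : CC) :
    contactForm p v = (1 / (2 * Real.pi)) * (cosQuot p * ((starRingEnd ℂ) (p 1) * v 1).im -
      sinQuot p * ((starRingEnd ℂ) (p 0) * v 0).im) := by
  have := Real.pi_ne_zero
  rw [contactForm, cosQuot, sinQuot]
  field_simp
  ring

theorem dContactForm_eq_quot {p : CC} (hp : p ∈ S3) (u v : CC) :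
    dContactForm p u v = -(3 / 2) *
      (cosQuot p * ‖p 1‖ ^ 2 * ((starRingEnd ℂ) (u 0) * v 0).im -
        sinQuot p * ‖p 0‖ ^ 2 * ((starRingEnd ℂ) (u 1) * v 1).im) := by
  have h : ‖p 1‖ ^ 2 = 1 - ‖p 0‖ ^ 2 := by linarith [(mem_S3_iff p).1 hp]
  rw [cosQuot_mul hp, sinQuot_mul, dContactForm_eq, h, cos_three_halves_pi_sub]
  ring

/-! ### Linear algebra of the contact planes -/

theorem dContactForm_self (p u : CC) : dContactForm p u u = 0 := by simp [dContactForm]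

theorem dContactForm_swap (p u v : CC) : dContactForm p u v = -dContactForm p v u := by
  simp [dContactForm]

theorem dContactForm_add_left (p u u' v : CC) :
    dContactForm p (u + u') v = dContactForm p u v + dContactForm p u' v := by
  simp only [dContactForm_eq, PiLp.add_apply, map_add, add_mul, Complex.add_im]; ring

theorem dContactForm_smul_left (p u v : CC) (a : ℝ) :
    dContactForm p (a • u) v = a * dContactForm p u v := by
  simp [dContactForm_eq]; ring

/-- The two linear equations of the contact plane. -/
def planeMap (p : CC) : CC →ₗ[ℝ] ℝ × ℝ where
  toFun v := (inner ℝ p v, contactForm p v)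
  map_add' u v := by
    ext
    · exact inner_add_right p u v
    · simp [contactForm]; ring
  map_smul' a v := by
    ext
    · exact inner_smul_right p v a
    · simp [contactForm]; ring

theorem mem_ker_planeMap (p v : CC) : v ∈ (planeMap p).ker ↔ v ∈ contactPlane p := by
  simp [planeMap, contactPlane]

theorem planeMap_surjective {p : CC} (hp : p ∈ S3) : Function.Surjective (planeMap p) := by
  have hpp : inner ℝ p p = (1 : ℝ) := by
    rw [real_inner_self_eq_norm_sq, mem_sphere_zero_iff_norm.1 hp, one_pow]
  have hself (a : ℂ) : ((starRingEnd ℂ) a * a).im = 0 := by simp; ring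
  have hap : contactForm p p = 0 := by rw [contactForm_eq_quot, hself, hself]; simp
  -- A vector tangent to the sphere on which α is a positive multiple of a sum of two squares. Both
  -- squares vanish only if sin θ = cos θ = 0, so R and the radial vector p together show
  -- surjectivity.
  set R : CC := !₂[-(sinQuot p : ℂ) * Complex.I * p 0, (cosQuot p : ℂ) * Complex.I * p 1] with hR
  have hpR : inner ℝ p R = (0 : ℝ) := by
    rw [inner_CC, hR]; simp; ring
  have haR : contactForm p R =
      (1 / (2 * Real.pi)) * ((cosQuot p * ‖p 1‖) ^ 2 + (sinQuot p * ‖p 0‖) ^ 2) := by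
    rw [contactForm_eq_quot, hR, mul_pow, mul_pow, Complex.sq_norm, Complex.sq_norm,
      Complex.normSq_apply, Complex.normSq_apply]
    simp; ring
  have hne : contactForm p R ≠ 0 := by
    rw [haR]
    intro h
    have h1 : (cosQuot p * ‖p 1‖) ^ 2 + (sinQuot p * ‖p 0‖) ^ 2 = 0 := by
      rcases mul_eq_zero.1 h with h | h
      · exact absurd h (by positivity)
      · exact h
    have h2 : cosQuot p * ‖p 1‖ = 0 := by nlinarith [sq_nonneg (sinQuot p * ‖p 0‖)]
    have h3 : sinQuot p * ‖p 0‖ = 0 := by nlinarith [sq_nonneg (cosQuot p * ‖p 1‖)]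
    have h4 : Real.cos (3 * Real.pi / 2 * ‖p 0‖ ^ 2) = 0 := by
      linear_combination ‖p 1‖ * h2 - cosQuot_mul hp
    have h5 : Real.sin (3 * Real.pi / 2 * ‖p 0‖ ^ 2) = 0 := by
      linear_combination ‖p 0‖ * h3 - sinQuot_mul p
    have h6 := Real.sin_sq_add_cos_sq (3 * Real.pi / 2 * ‖p 0‖ ^ 2)
    rw [h4, h5] at h6
    norm_num at h6
  rintro ⟨a, b⟩
  refine ⟨a • p + (b / contactForm p R) • R, ?_⟩
  rw [map_add, map_smul, map_smul]
  ext
  · change a * inner ℝ p p + b / contactForm p R * inner ℝ p R = a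
    rw [hpp, hpR]; ring
  · change a * contactForm p p + b / contactForm p R * contactForm p R = b
    rw [hap, div_mul_cancel₀ _ hne]; ring

theorem finrank_ker_planeMap {p : CC} (hp : p ∈ S3) :
    Module.finrank ℝ (planeMap p).ker = 2 := by
  have h := (planeMap p).finrank_range_add_finrank_ker
  rw [LinearMap.range_eq_top.2 (planeMap_surjective hp), finrank_top,
    finrank_real_of_complex] at h
  simp at h
  omega

theorem linearIndependent_of_dContactForm {p u v : CC} (h : dContactForm p u v ≠ 0) :
    LinearIndependent ℝ ![u, v] := by
  rw [LinearIndependent.pair_iff]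
  intro a b hab
  have h1 : dContactForm p (a • u + b • v) v = 0 := by rw [hab]; simp [dContactForm_eq]
  have h2 : dContactForm p (a • u + b • v) u = 0 := by rw [hab]; simp [dContactForm_eq]
  rw [dContactForm_add_left, dContactForm_smul_left, dContactForm_smul_left,
    dContactForm_self] at h1 h2
  rw [dContactForm_swap p v u] at h2
  constructor
  · simpa [h] using h1
  · simpa [h] using h2

/-- Cramer's rule in the contact plane. -/
theorem eq_combination {p u v w : CC} (hp : p ∈ S3) (hu : u ∈ contactPlane p)
    (hv : v ∈ contactPlane p) (hw : w ∈ contactPlane p) (h : dContactForm p u v ≠ 0) :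
    w = (dContactForm p w v / dContactForm p u v) • u +
      (dContactForm p u w / dContactForm p u v) • v := by
  let b : Fin 2 → (planeMap p).ker :=
    ![⟨u, (mem_ker_planeMap p u).2 hu⟩, ⟨v, (mem_ker_planeMap p v).2 hv⟩]
  have hb : LinearIndependent ℝ b := by
    have := linearIndependent_of_dContactForm h
    rw [LinearIndependent.pair_iff] at this ⊢
    intro s t hst
    exact this s t (congrArg Subtype.val hst)
  have hspan := hb.span_eq_top_of_card_eq_finrank (by rw [finrank_ker_planeMap hp]; simp)
  have hmem : (⟨w, (mem_ker_planeMap p w).2 hw⟩ : (planeMap p).ker) ∈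
      Submodule.span ℝ (Set.range b) := by rw [hspan]; trivial
  rw [Matrix.range_cons, Matrix.range_cons, Matrix.range_empty, Set.union_empty,
    Set.singleton_union, Submodule.mem_span_pair] at hmem
  obtain ⟨s, t, hst⟩ := hmem
  have hw' : s • u + t • v = w := congrArg Subtype.val hst
  have e1 : dContactForm p w v = s * dContactForm p u v := by
    rw [← hw', dContactForm_add_left, dContactForm_smul_left, dContactForm_smul_left,
      dContactForm_self]; ring
  have e2 : dContactForm p u w = t * dContactForm p u v := by
    rw [dContactForm_swap, ← hw', dContactForm_add_left, dContactForm_smul_left,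
      dContactForm_smul_left, dContactForm_self, dContactForm_swap p v u]; ring
  rw [e1, e2, mul_div_cancel_right₀ _ h, mul_div_cancel_right₀ _ h, hw']

/-! ### The global frame -/

theorem continuous_sinQuot : Continuous sinQuot :=
  continuous_const.mul (Real.continuous_sinc.comp (by fun_prop))

theorem continuous_cosQuot : Continuous cosQuot :=
  (continuous_const.mul (Real.continuous_sinc.comp (by fun_prop))).neg

/-- A coefficient of the global frame; on the sphere it extends continuously by `0` to `p 0 = 0`. -/
def frameCoeff₀ (p : CC) : ℂ := (1 - cosQuot p : ℝ) * (p 0 / (starRingEnd ℂ) (p 0))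

/-- A coefficient of the global frame; on the sphere it extends continuously by `0` to `p 1 = 0`. -/
def frameCoeff₁ (p : CC) : ℂ := (1 + sinQuot p : ℝ) * (p 1 / (starRingEnd ℂ) (p 1))

theorem norm_div_conj_le (a : ℂ) : ‖a / (starRingEnd ℂ) a‖ ≤ 1 := by
  rw [norm_div, Complex.norm_conj]
  exact div_self_le_one _

/-- The phase a / conj a is bounded by 1 everywhere (it is 0 where a = 0, by the convention for
division), so a factor f vanishing there removes the discontinuity. -/
theorem continuous_mul_div_conj {X : Type*} [TopologicalSpace X] {f : X → ℝ} {a : X → ℂ}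
    (hf : Continuous f) (ha : Continuous a) (h : ∀ x, a x = 0 → f x = 0) :
    Continuous fun x => (f x : ℂ) * (a x / (starRingEnd ℂ) (a x)) := by
  rw [continuous_iff_continuousAt]
  intro x
  by_cases hx : a x = 0
  · have h0 : Filter.Tendsto (fun x => |f x|) (nhds x) (nhds 0) := by
      have := hf.abs.tendsto x
      rwa [h x hx, abs_zero] at this
    rw [ContinuousAt, h x hx, Complex.ofReal_zero, zero_mul]
    refine squeeze_zero_norm (fun y => ?_) h0
    rw [norm_mul, Complex.norm_real, Real.norm_eq_abs]
    exact mul_le_of_le_one_right (abs_nonneg _) (norm_div_conj_le _)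
  · have : (starRingEnd ℂ) (a x) ≠ 0 := by simpa using hx
    have hc : Continuous fun x => (starRingEnd ℂ) (a x) := Complex.continuous_conj.comp ha
    exact (Complex.continuous_ofReal.comp hf).continuousAt.mul
      (ha.continuousAt.div hc.continuousAt this)

theorem continuous_frameCoeff₀ : Continuous fun p : S3 => frameCoeff₀ p :=
  continuous_mul_div_conj (continuous_const.sub (continuous_cosQuot.comp continuous_subtype_val))
    (by fun_prop) fun p hp => by simp [cosQuot_eq_of_zero p.2 hp]

theorem continuous_frameCoeff₁ : Continuous fun p : S3 => frameCoeff₁ p :=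
  continuous_mul_div_conj (continuous_const.add (continuous_sinQuot.comp continuous_subtype_val))
    (by fun_prop) fun p hp => by simp [sinQuot_eq_of_zero p.2 hp]

theorem frameCoeff₀_mul_conj (p : CC) :
    frameCoeff₀ p * (starRingEnd ℂ) (p 0) = (1 - cosQuot p : ℝ) * p 0 := by
  by_cases h : p 0 = 0
  · simp [h]
  · have : (starRingEnd ℂ) (p 0) ≠ 0 := by simpa using h
    rw [frameCoeff₀]; field_simp

theorem frameCoeff₁_mul_conj (p : CC) :
    frameCoeff₁ p * (starRingEnd ℂ) (p 1) = (1 + sinQuot p : ℝ) * p 1 := by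
  by_cases h : p 1 = 0
  · simp [h]
  · have : (starRingEnd ℂ) (p 1) ≠ 0 := by simpa using h
    rw [frameCoeff₁]; field_simp

theorem normSq_div_conj {a : ℂ} (h : a ≠ 0) : Complex.normSq (a / (starRingEnd ℂ) a) = 1 := by
  have : Complex.normSq a ≠ 0 := by simpa using h
  rw [Complex.normSq_div, Complex.normSq_conj, div_self this]

theorem normSq_frameCoeff₀ {p : CC} (hp : p ∈ S3) :
    Complex.normSq (frameCoeff₀ p) = (1 - cosQuot p) ^ 2 := by
  rw [frameCoeff₀, Complex.normSq_mul, Complex.normSq_ofReal, ← sq]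
  by_cases h : p 0 = 0
  · rw [cosQuot_eq_of_zero hp h]; simp
  · rw [normSq_div_conj h, mul_one]

theorem normSq_frameCoeff₁ {p : CC} (hp : p ∈ S3) :
    Complex.normSq (frameCoeff₁ p) = (1 + sinQuot p) ^ 2 := by
  rw [frameCoeff₁, Complex.normSq_mul, Complex.normSq_ofReal, ← sq]
  by_cases h : p 1 = 0
  · rw [sinQuot_eq_of_zero hp h]; simp
  · rw [normSq_div_conj h, mul_one]

/-- A global real-linear trivialization of the contact structure, as a map from `ℂ` to the
contact plane at `p`. -/
def frameMap (p : CC) (ζ : ℂ) : CC :=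
  !₂[1 / 2 * (frameCoeff₀ p * p 1 * ζ + (1 + cosQuot p : ℝ) * (starRingEnd ℂ) (p 1 * ζ)),
    -(1 / 2) * (frameCoeff₁ p * p 0 * ζ + (1 - sinQuot p : ℝ) * (starRingEnd ℂ) (p 0 * ζ))]

theorem frameMap_zero (p : CC) (ζ : ℂ) : frameMap p ζ 0 =
    1 / 2 * (frameCoeff₀ p * p 1 * ζ + (1 + cosQuot p : ℝ) * (starRingEnd ℂ) (p 1 * ζ)) := rfl

theorem frameMap_one (p : CC) (ζ : ℂ) : frameMap p ζ 1 =
    -(1 / 2) * (frameCoeff₁ p * p 0 * ζ + (1 - sinQuot p : ℝ) * (starRingEnd ℂ) (p 0 * ζ)) := rfl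

theorem frameMap_add (p : CC) (ζ η : ℂ) : frameMap p (ζ + η) = frameMap p ζ + frameMap p η := by
  ext i
  fin_cases i
  · simp [frameMap]; ring
  · simp [frameMap]; ring

theorem frameMap_ofReal_mul (p : CC) (a : ℝ) (ζ : ℂ) : frameMap p (a * ζ) = a • frameMap p ζ := by
  ext i
  fin_cases i
  · simp [frameMap]; ring
  · simp [frameMap]; ring

theorem frameMap_mem (p : CC) (ζ : ℂ) : frameMap p ζ ∈ contactPlane p := by
  have e0 : (starRingEnd ℂ) (p 0) * frameMap p ζ 0 =
      1 / 2 * ((1 - cosQuot p : ℝ) * (p 0 * p 1 * ζ) +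
        (1 + cosQuot p : ℝ) * (starRingEnd ℂ) (p 0 * p 1 * ζ)) := by
    rw [frameMap_zero]
    simp only [map_mul]
    linear_combination (1 / 2 * p 1 * ζ) * frameCoeff₀_mul_conj p
  have e1 : (starRingEnd ℂ) (p 1) * frameMap p ζ 1 =
      -(1 / 2) * ((1 + sinQuot p : ℝ) * (p 0 * p 1 * ζ) +
        (1 - sinQuot p : ℝ) * (starRingEnd ℂ) (p 0 * p 1 * ζ)) := by
    rw [frameMap_one]
    simp only [map_mul]
    linear_combination (-(1 / 2) * p 0 * ζ) * frameCoeff₁_mul_conj p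
  generalize p 0 * p 1 * ζ = m at e0 e1
  constructor
  · rw [inner_CC, e0, e1]
    simp
    ring
  · rw [contactForm_eq_quot, e0, e1]
    simp
    ring_nf

/-- The real-linear map ξ ↦ Aξ + k conj ξ has determinant |A|² - k², and multiplication by w has
determinant |w|². -/
theorem im_conj_mul_aux (A ζ η w : ℂ) (k : ℝ) :
    ((starRingEnd ℂ) (A * w * ζ + k * (starRingEnd ℂ) (w * ζ)) *
      (A * w * η + k * (starRingEnd ℂ) (w * η))).im =
      (Complex.normSq A - k ^ 2) * ‖w‖ ^ 2 * ((starRingEnd ℂ) ζ * η).im := by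
  rw [Complex.sq_norm, Complex.normSq_apply, Complex.normSq_apply]
  simp
  ring

/-- The determinants of the two components are proportional to -`cosQuot` and `sinQuot`, so dα pulls
back to a constant multiple of cos²θ + sin²θ = 1 times the area form. Positivity and independence of
the frame follow at every point, cores included. -/
theorem dContactForm_frameMap {p : CC} (hp : p ∈ S3) (ζ η : ℂ) :
    dContactForm p (frameMap p ζ) (frameMap p η) = 3 / 2 * ((starRingEnd ℂ) ζ * η).im := by
  have e (c x y : ℂ) (hc : (starRingEnd ℂ) c * c = (1 / 4 : ℝ)) :
      ((starRingEnd ℂ) (c * x) * (c * y)).im = 1 / 4 * ((starRingEnd ℂ) x * y).im := by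
    rw [map_mul, show (starRingEnd ℂ) c * (starRingEnd ℂ) x * (c * y) =
      ((starRingEnd ℂ) c * c) * ((starRingEnd ℂ) x * y) by ring, hc, Complex.im_ofReal_mul]
  rw [dContactForm_eq_quot hp, frameMap_zero, frameMap_zero, frameMap_one, frameMap_one,
    e _ _ _ (by simp [map_ofNat]; norm_num), e _ _ _ (by simp [map_ofNat]; norm_num),
    im_conj_mul_aux, im_conj_mul_aux,
    normSq_frameCoeff₀ hp, normSq_frameCoeff₁ hp]
  have h1 := sinQuot_mul p
  have h2 := cosQuot_mul hp
  have h3 := Real.sin_sq_add_cos_sq (3 * Real.pi / 2 * ‖p 0‖ ^ 2)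
  rw [← h1, ← h2] at h3
  linear_combination (3 / 2 * ((starRingEnd ℂ) ζ * η).im) * h3

theorem continuous_frameMap (ζ : ℂ) : Continuous fun p : S3 => frameMap p ζ := by
  have c0 := continuous_frameCoeff₀
  have c1 := continuous_frameCoeff₁
  have c2 : Continuous fun p : S3 => cosQuot p := continuous_cosQuot.comp continuous_subtype_val
  have c3 : Continuous fun p : S3 => sinQuot p := continuous_sinQuot.comp continuous_subtype_val
  refine (PiLp.continuous_toLp 2 _).comp (continuous_pi fun i => ?_)
  fin_cases i
  · simp only [Fin.zero_eta, Matrix.cons_val_zero]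
    fun_prop
  · simp only [Fin.mk_one, Matrix.cons_val_one]
    fun_prop

/-- The parallelization of `ζ₁` given by `frameMap`. -/
def standardParallelization : Parallelization where
  e₁ p := frameMap p 1
  e₂ p := frameMap p Complex.I
  continuous₁ := continuous_frameMap 1
  continuous₂ := continuous_frameMap Complex.I
  mem₁ p := frameMap_mem p 1
  mem₂ p := frameMap_mem p Complex.I
  linearIndependent p :=
    linearIndependent_of_dContactForm (p := p) (by rw [dContactForm_frameMap p.2]; simp)
  positive p := by rw [dContactForm_frameMap p.2]; simp

/-- The inverse of `frameMap` on the contact plane. -/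
def frameCoord (p v : CC) : ℂ :=
  ⟨2 / 3 * dContactForm p v (frameMap p Complex.I), 2 / 3 * dContactForm p (frameMap p 1) v⟩

theorem frameCoord_frameMap {p : CC} (hp : p ∈ S3) (ζ : ℂ) : frameCoord p (frameMap p ζ) = ζ := by
  apply Complex.ext
  · simp [frameCoord, dContactForm_frameMap hp]; ring
  · simp [frameCoord, dContactForm_frameMap hp]; ring

theorem frameMap_frameCoord {p v : CC} (hp : p ∈ S3) (hv : v ∈ contactPlane p) :
    frameMap p (frameCoord p v) = v := by
  have h1 : dContactForm p (frameMap p 1) (frameMap p Complex.I) = 3 / 2 := by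
    rw [dContactForm_frameMap hp]; simp
  have h := eq_combination hp (frameMap_mem p 1) (frameMap_mem p Complex.I) hv
    (by rw [h1]; norm_num)
  rw [h1] at h
  conv_rhs => rw [h]
  have hz : frameCoord p v = ((frameCoord p v).re : ℂ) * 1 + ((frameCoord p v).im : ℂ) * Complex.I := by
    rw [mul_one, Complex.re_add_im]
  rw [hz, frameMap_add, frameMap_ofReal_mul, frameMap_ofReal_mul]
  simp only [frameCoord]
  congr 2 <;> ring

theorem continuous_dContactForm {X : Type*} [TopologicalSpace X] {p u v : X → CC}
    (hp : Continuous p) (hu : Continuous u) (hv : Continuous v) :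
    Continuous fun x => dContactForm (p x) (u x) (v x) := by
  simp only [dContactForm_eq]
  fun_prop

theorem continuous_frameCoord {X : Type*} [TopologicalSpace X] {p : X → S3} {v : X → CC}
    (hp : Continuous p) (hv : Continuous v) : Continuous fun x => frameCoord (p x) (v x) := by
  have hp' : Continuous fun x => (p x : CC) := continuous_subtype_val.comp hp
  have h1 := continuous_dContactForm hp' hv ((continuous_frameMap Complex.I).comp hp)
  have h2 := continuous_dContactForm hp' ((continuous_frameMap 1).comp hp) hv
  have : (fun x => frameCoord (p x) (v x)) = fun x =>
      ((2 / 3 * dContactForm (p x) (v x) (frameMap (p x) Complex.I) : ℝ) : ℂ) +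
        ((2 / 3 * dContactForm (p x) (frameMap (p x) 1) (v x) : ℝ) : ℂ) * Complex.I := by
    ext x
    rw [frameCoord, Complex.mk_eq_add_mul_I]
  rw [this]
  simp only [Function.comp_def] at h1 h2
  fun_prop

/-! ### Continuous angles -/

/-- V is simply connected, so g lifts through the covering exp : ℂ → ℂ∖{0}; the angle is the
imaginary part of the lift. -/
theorem exists_continuous_angle {V : Type*} [NormedAddCommGroup V] [NormedSpace ℝ V] {g : V → ℂ}
    (hg : Continuous g) (h0 : ∀ v, g v ≠ 0) :
    ∃ φ : V → ℝ, Continuous φ ∧ ∀ v, g v = ‖g v‖ * Complex.exp (φ v * Complex.I) := by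
  obtain ⟨F, ⟨-, hF⟩, -⟩ := Complex.isCoveringMapOn_exp.existsUnique_continuousMap_lifts
    ⟨g, hg⟩ (a₀ := 0) (e₀ := Complex.log (g 0)) (Complex.exp_log (h0 0)) h0
  refine ⟨fun v => (F v).im, Complex.continuous_im.comp F.continuous, fun v => ?_⟩
  have h : Complex.exp (F v) = g v := congrFun hF v
  rw [← h, Complex.norm_exp, Complex.ofReal_exp, ← Complex.exp_add, Complex.re_add_im]

/-- The real-linear map 1 ↦ 1, i ↦ m has eigenvalues 1 and Im m, both positive, so it never sends
the unit vector exp(ix) to zero or to a negative multiple of itself. -/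
theorem slitPlane_of_im_pos {m : ℂ} (hm : 0 < m.im) (x : ℝ) :
    ((Real.cos x : ℂ) + Real.sin x * m) * Complex.exp (-(x * Complex.I)) ∈ Complex.slitPlane := by
  have he : Complex.exp (-(x * Complex.I)) = (Real.cos x : ℂ) - Real.sin x * Complex.I := by
    rw [← neg_mul, Complex.exp_mul_I, Complex.cos_neg, Complex.sin_neg, Complex.ofReal_cos,
      Complex.ofReal_sin]
    ring
  have h1 := Real.sin_sq_add_cos_sq x
  rw [he, Complex.mem_slitPlane_iff]
  generalize Real.sin x = s at *
  generalize Real.cos x = c at *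
  simp only [Complex.mul_re, Complex.mul_im, Complex.add_re, Complex.add_im, Complex.sub_re,
    Complex.sub_im, Complex.ofReal_re, Complex.ofReal_im, Complex.I_re, Complex.I_im]
  by_contra! hcon
  obtain ⟨hre, him⟩ := hcon
  by_cases hs : s = 0
  · subst hs
    nlinarith
  · have h2 : c * m.im = c + s * m.re := by
      apply mul_left_cancel₀ hs
      linear_combination him
    have h3 : m.im ≤ 0 := by linear_combination hre - m.im * h1 + c * h2
    linarith

/-! ### Counting half-turns -/

theorem eventually_sign_sub (t z : ℝ) : ∀ᶠ s in 𝓝 t, (SignType.sign (s - z) : ℤ) =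
    SignType.sign (t - z) + if z = t then (SignType.sign (s - t) : ℤ) else 0 := by
  rcases lt_trichotomy t z with h | h | h
  · filter_upwards [eventually_lt_nhds h] with s hs
    rw [if_neg h.ne', sign_neg (sub_neg.2 hs), sign_neg (sub_neg.2 h), add_zero]
  · subst h; simp
  · filter_upwards [eventually_gt_nhds h] with s hs
    rw [if_neg h.ne, sign_pos (sub_pos.2 hs), sign_pos (sub_pos.2 h), add_zero]

/-- A function which is locally a step function of half-jumps `ε` has finitely many jumps in the
unit interval. -/
theorem finite_jumps {S ε : ℝ → ℤ}
    (h : ∀ t, ∀ᶠ s in 𝓝 t, S s = S t + ε t * SignType.sign (s - t)) :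
    {t ∈ Set.Icc (0 : ℝ) 1 | ε t ≠ 0}.Finite := by
  by_contra hinf
  obtain ⟨x, -, hx⟩ := Set.Infinite.exists_accPt_of_subset_isCompact hinf isCompact_Icc
    (fun t ht => ht.1)
  rw [accPt_iff_frequently_nhdsNE] at hx
  refine hx ?_
  -- Near an accumulation point x, S is constant on each side of x, so no t ≠ x close to x can carry
  -- a jump.
  have h1 := (eventually_eventually_nhds.2 (h x)).filter_mono (nhdsWithin_le_nhds (s := {x}ᶜ))
  filter_upwards [h1, self_mem_nhdsWithin] with t ht htx hmem
  have hx' : x ≠ t := fun h => htx h.symm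
  have h2 : ∀ᶠ s in 𝓝[>] t, ε t = 0 := by
    filter_upwards [(ht.and ((h t).and (eventually_sign_sub t x))).filter_mono nhdsWithin_le_nhds,
      self_mem_nhdsWithin] with s hs hst
    obtain ⟨a, b, c⟩ := hs
    rw [if_neg hx', add_zero] at c
    have hd := ht.self_of_nhds
    rw [sign_pos (sub_pos.2 hst)] at b
    rw [c, ← hd, b] at a
    simpa using a
  obtain ⟨_, h3⟩ := h2.exists
  exact hmem.2 h3

theorem jump_count {S ε : ℝ → ℤ} (h : ∀ t, ∀ᶠ s in 𝓝 t, S s = S t + ε t * SignType.sign (s - t))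
    (hper : ε 1 = ε 0) :
    S 1 - S 0 = 2 * ∑ z ∈ (finite_jumps h).toFinset with z < 1, ε z := by
  set G := (finite_jumps h).toFinset with hG
  have memG (z : ℝ) : z ∈ G ↔ z ∈ Set.Icc (0 : ℝ) 1 ∧ ε z ≠ 0 := by simp [hG]
  -- The explicit step function with the same jumps; S - M is locally constant on [0,1], hence
  -- constant.
  let M : ℝ → ℤ := fun t => ∑ z ∈ G, ε z * SignType.sign (t - z)
  have hsum (t : ℝ) (ht : t ∈ Set.Icc (0 : ℝ) 1) (a : ℤ) :
      ∑ z ∈ G, ε z * (if z = t then a else 0) = ε t * a := by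
    simp only [mul_ite, mul_zero, Finset.sum_ite_eq']
    split_ifs with hm
    · rfl
    · have : ε t = 0 := by
        by_contra hne
        exact hm ((memG t).2 ⟨ht, hne⟩)
      rw [this, zero_mul]
  have hM (t : ℝ) (ht : t ∈ Set.Icc (0 : ℝ) 1) :
      ∀ᶠ s in 𝓝 t, M s = M t + ε t * SignType.sign (s - t) := by
    have : ∀ᶠ s in 𝓝 t, ∀ z ∈ G, (SignType.sign (s - z) : ℤ) =
        SignType.sign (t - z) + if z = t then (SignType.sign (s - t) : ℤ) else 0 :=
      (Filter.eventually_all_finset G).2 fun z _ => eventually_sign_sub t z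
    filter_upwards [this] with s hs
    rw [← hsum t ht, ← Finset.sum_add_distrib]
    refine Finset.sum_congr rfl fun z hz => ?_
    rw [hs z hz, mul_add]
  have hc : ContinuousOn (fun t => S t - M t) (Set.Icc 0 1) := by
    intro t ht
    have h1 : ∀ᶠ s in 𝓝 t, S s - M s = S t - M t := by
      filter_upwards [h t, hM t ht] with s h1 h2
      rw [h1, h2]; ring
    exact (continuousAt_const.congr (f := fun _ => S t - M t)
      (h1.mono fun s hs => hs.symm)).continuousWithinAt
  have hconst := isPreconnected_Icc.constant hc (x := 1) (y := 0) (by simp) (by simp)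
  -- An interior jump counts twice, while jumps at 0 and 1 count once each. Since ε 1 = ε 0, these
  -- two halves combine into one full jump at 0, which matches the half-open interval [0,1).
  have hcoef (z : ℝ) (hz : z ∈ Set.Icc (0 : ℝ) 1) : (SignType.sign (1 - z) : ℤ) -
      SignType.sign (0 - z) =
      2 * (if z < 1 then 1 else 0) - (if z = 0 then 1 else 0) + (if z = 1 then 1 else 0) := by
    rcases hz.1.eq_or_lt with h0 | h0
    · subst h0; simp
    · rcases hz.2.eq_or_lt with h1 | h1
      · subst h1; simp
      · rw [sign_pos (sub_pos.2 h1), sign_neg (sub_neg.2 h0), if_pos h1, if_neg h0.ne',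
          if_neg h1.ne]
        simp
  have hdiff : M 1 - M 0 = 2 * ∑ z ∈ G with z < 1, ε z := by
    have e : M 1 - M 0 = ∑ z ∈ G, (2 * (if z < 1 then ε z else 0) -
        ε z * (if z = 0 then 1 else 0) + ε z * (if z = 1 then 1 else 0)) := by
      rw [← Finset.sum_sub_distrib]
      refine Finset.sum_congr rfl fun z hz => ?_
      rw [← mul_sub, hcoef z ((memG z).1 hz).1]
      split_ifs <;> ring
    rw [e, Finset.sum_add_distrib, Finset.sum_sub_distrib, hsum 0 (by simp), hsum 1 (by simp),
      ← Finset.mul_sum, ← Finset.sum_filter, hper]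
    ring
  rw [← hdiff]
  linarith

/-- The step function with jumps of height `2` at the multiples of `π`. -/
def halfTurns (x : ℝ) : ℤ := ⌊x / Real.pi⌋ + ⌈x / Real.pi⌉

theorem halfTurns_int_mul (k : ℤ) : halfTurns (k * Real.pi) = 2 * k := by
  rw [halfTurns, mul_div_cancel_right₀ _ Real.pi_ne_zero, Int.floor_intCast, Int.ceil_intCast]
  ring

theorem halfTurns_of_mem_Ioo {x : ℝ} {k : ℤ} (h1 : k * Real.pi < x) (h2 : x < (k + 1) * Real.pi) :
    halfTurns x = 2 * k + 1 := by
  have a : (k : ℝ) < x / Real.pi := by rwa [lt_div_iff₀ Real.pi_pos]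
  have b : x / Real.pi < k + 1 := by rwa [div_lt_iff₀ Real.pi_pos]
  have e1 : ⌊x / Real.pi⌋ = k := Int.floor_eq_iff.2 ⟨a.le, b⟩
  have e2 : ⌈x / Real.pi⌉ = k + 1 := Int.ceil_eq_iff.2 ⟨by push_cast; linarith, by push_cast; linarith⟩
  rw [halfTurns, e1, e2]; ring

/-- `halfTurns` is 2k at kπ and 2k + 1 between kπ and (k+1)π. Passing kπ therefore changes it by one
on arrival and by one on departure, in the direction ε in which φ moves. -/
theorem halfTurns_step {φ : ℝ → ℝ} (hφ : Continuous φ) {ε : ℝ → ℤ}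
    (hε : ∀ t, ε t = 1 ∨ ε t = 0 ∨ ε t = -1) (h0 : ∀ t, Real.sin (φ t) ≠ 0 → ε t = 0)
    (h1 : ∀ t, Real.sin (φ t) = 0 →
      ∀ᶠ s in 𝓝[≠] t, 0 < ε t * (Real.sin (φ s - φ t) * (s - t))) (t : ℝ) :
    ∀ᶠ s in 𝓝 t, halfTurns (φ s) = halfTurns (φ t) + ε t * SignType.sign (s - t) := by
  have hpi := Real.pi_pos
  by_cases ht : Real.sin (φ t) = 0
  · obtain ⟨k, hk⟩ := Real.sin_eq_zero_iff.1 ht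
    have hlo : ∀ᶠ s in 𝓝 t, φ t - Real.pi < φ s :=
      hφ.continuousAt.eventually_const_lt (by linarith)
    have hhi : ∀ᶠ s in 𝓝 t, φ s < φ t + Real.pi :=
      hφ.continuousAt.eventually_lt_const (by linarith)
    have hne := eventually_nhdsWithin_iff.1 (h1 t ht)
    filter_upwards [hlo, hhi, hne] with s a b c
    by_cases hst : s = t
    · subst hst; simp
    have c := c hst
    have hft : halfTurns (φ t) = 2 * k := by rw [← hk, halfTurns_int_mul]
    have up (hd : 0 < Real.sin (φ s - φ t)) : halfTurns (φ s) = 2 * k + 1 := by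
      refine halfTurns_of_mem_Ioo ?_ (by linarith)
      by_contra! hle
      have := Real.sin_nonpos_of_nonpos_of_neg_pi_le (x := φ s - φ t) (by linarith) (by linarith)
      linarith
    have down (hd : Real.sin (φ s - φ t) < 0) : halfTurns (φ s) = 2 * (k - 1) + 1 := by
      refine halfTurns_of_mem_Ioo (by push_cast; linarith) ?_
      by_contra! hle
      have := Real.sin_nonneg_of_nonneg_of_le_pi (x := φ s - φ t)
        (by push_cast at hle; linarith) (by linarith)
      linarith
    rcases lt_or_gt_of_ne hst with hlt | hgt
    · rw [sign_neg (sub_neg.2 hlt), hft]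
      rcases hε t with e | e | e
      · rw [e] at c ⊢
        rw [down (by push_cast at c; nlinarith)]; simp; ring
      · rw [e] at c; simp at c
      · rw [e] at c ⊢
        rw [up (by push_cast at c; nlinarith)]; simp
    · rw [sign_pos (sub_pos.2 hgt), hft]
      rcases hε t with e | e | e
      · rw [e] at c ⊢
        rw [up (by push_cast at c; nlinarith)]; simp
      · rw [e] at c; simp at c
      · rw [e] at c ⊢
        rw [down (by push_cast at c; nlinarith)]; simp; ring
  · set k := ⌊φ t / Real.pi⌋ with hk
    have a : (k : ℝ) * Real.pi ≤ φ t := by rw [← le_div_iff₀ hpi]; exact Int.floor_le _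
    have b : φ t < (k + 1) * Real.pi := by rw [← div_lt_iff₀ hpi]; exact Int.lt_floor_add_one _
    have a' : (k : ℝ) * Real.pi < φ t := by
      refine lt_of_le_of_ne a fun e => ht ?_
      rw [← e, Real.sin_int_mul_pi]
    rw [h0 t ht]
    filter_upwards [hφ.continuousAt.eventually_const_lt a', hφ.continuousAt.eventually_lt_const b]
      with s ha hb
    rw [halfTurns_of_mem_Ioo ha hb, halfTurns_of_mem_Ioo a' b]; simp

theorem two_mul_turns_eq {φ : ℝ → ℝ} (hφ : Continuous φ) {ε : ℝ → ℤ}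
    (hε : ∀ t, ε t = 1 ∨ ε t = 0 ∨ ε t = -1) (h0 : ∀ t, Real.sin (φ t) ≠ 0 → ε t = 0)
    (h1 : ∀ t, Real.sin (φ t) = 0 →
      ∀ᶠ s in 𝓝[≠] t, 0 < ε t * (Real.sin (φ s - φ t) * (s - t)))
    (hper : ε 1 = ε 0) {r : ℤ} (hr : φ 1 = φ 0 + 2 * Real.pi * r) :
    2 * r = ({t ∈ Set.Ico (0 : ℝ) 1 | ε t = 1}.ncard : ℤ) -
      {t ∈ Set.Ico (0 : ℝ) 1 | ε t = -1}.ncard := by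
  have hstep := halfTurns_step hφ hε h0 h1
  have hcount := jump_count (S := fun t => halfTurns (φ t)) hstep hper
  set G := (finite_jumps (S := fun t => halfTurns (φ t)) hstep).toFinset with hG
  have memG (z : ℝ) : z ∈ G ↔ z ∈ Set.Icc (0 : ℝ) 1 ∧ ε z ≠ 0 := by simp [hG]
  -- One revolution is two multiples of π, and each raises both the floor and the ceiling by 1.
  have hS : halfTurns (φ 1) = halfTurns (φ 0) + 2 * (2 * r) := by
    have : φ 1 / Real.pi = φ 0 / Real.pi + ((2 * r : ℤ) : ℝ) := by
      rw [hr]; push_cast; field_simp [Real.pi_ne_zero]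
    rw [halfTurns, halfTurns, this, Int.floor_add_intCast, Int.ceil_add_intCast]
    ring
  have hcard (c : ℤ) (hc : c ≠ 0) : {t ∈ Set.Ico (0 : ℝ) 1 | ε t = c}.ncard =
      (G.filter fun z => z < 1 ∧ ε z = c).card := by
    rw [← Set.ncard_coe_finset]
    congr 1
    ext z
    simp only [Set.mem_ofPred_eq, Set.mem_Ico, Finset.coe_filter, memG, Set.mem_Icc]
    constructor
    · rintro ⟨⟨a, b⟩, e⟩
      exact ⟨⟨⟨a, b.le⟩, by rw [e]; exact hc⟩, b, e⟩
    · rintro ⟨⟨⟨a, -⟩, -⟩, b, e⟩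
      exact ⟨⟨a, b⟩, e⟩
  have hsum : ∑ z ∈ G with z < 1, ε z =
      ((G.filter fun z => z < 1 ∧ ε z = 1).card : ℤ) -
        (G.filter fun z => z < 1 ∧ ε z = -1).card := by
    rw [← Finset.filter_filter, ← Finset.filter_filter, Finset.card_filter, Finset.card_filter]
    push_cast
    rw [← Finset.sum_sub_distrib]
    refine Finset.sum_congr rfl fun z hz => ?_
    rcases hε z with e | e | e <;> rw [e] <;> norm_num
  rw [hcard 1 one_ne_zero, hcard (-1) (by norm_num), ← hsum]
  linarith

/-! ### Derivatives of angles, local signs, and the frame in polar coordinates -/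

theorem hasDerivAt_angle {c : ℝ → ℂ} {c' : ℂ} {t : ℝ} (hc : HasDerivAt c c' t)
    (h0 : ∀ s, c s ≠ 0) {ψ : ℝ → ℝ} (hψ : Continuous ψ)
    (h : ∀ s, c s = ‖c s‖ * Complex.exp ((2 * Real.pi * ψ s : ℝ) * Complex.I)) :
    HasDerivAt ψ ((c' / c t).im / (2 * Real.pi)) t := by
  have hpi := Real.pi_pos
  have h1 : HasDerivAt (fun s => Complex.log (c s / c t)) (c' / c t) t := by
    -- Dividing by c t moves the base value to 1, where the principal logarithm is differentiable.
    -- Its imaginary part agrees with 2π(ψ s - ψ t) as long as ψ moves by less than 1/2.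
    have hd := (hc.div_const (c t)).clog_real (by rw [div_self (h0 t)]; simp)
    rwa [div_self (h0 t), div_one] at hd
  have h2 : HasDerivAt (fun s => (Complex.log (c s / c t)).im / (2 * Real.pi) + ψ t)
      ((c' / c t).im / (2 * Real.pi)) t :=
    ((Complex.imCLM.hasFDerivAt.comp_hasDerivAt t h1).div_const _).add_const _
  refine h2.congr_of_eventuallyEq ?_
  have a1 : ∀ᶠ s in 𝓝 t, ψ t - 1 / 2 < ψ s := hψ.continuousAt.eventually_const_lt (by linarith)
  have a2 : ∀ᶠ s in 𝓝 t, ψ s < ψ t + 1 / 2 := hψ.continuousAt.eventually_lt_const (by linarith)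
  filter_upwards [a1, a2] with s hs1 hs2
  have hq : c s / c t = ((‖c s‖ / ‖c t‖ : ℝ) : ℂ) * (Complex.cos ((2 * Real.pi * (ψ s - ψ t) : ℝ)) +
      Complex.sin ((2 * Real.pi * (ψ s - ψ t) : ℝ)) * Complex.I) := by
    rw [← Complex.exp_mul_I]
    conv_lhs => rw [h s, h t]
    rw [mul_div_mul_comm, ← Complex.exp_sub]
    push_cast
    congr 2
    ring
  have hpos : 0 < ‖c s‖ / ‖c t‖ := div_pos (norm_pos_iff.2 (h0 s)) (norm_pos_iff.2 (h0 t))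
  rw [Complex.log_im, hq, Complex.arg_mul_cos_add_sin_mul_I hpos ⟨by nlinarith, by nlinarith⟩]
  field_simp
  ring

theorem eq_norm_mul_exp_of_coe_eq {a : ℂ} {y : ℝ}
    (h : ((a.arg / (2 * Real.pi) : ℝ) : UnitAddCircle) = (y : UnitAddCircle)) :
    a = ‖a‖ * Complex.exp ((2 * Real.pi * y : ℝ) * Complex.I) := by
  rw [← sub_eq_zero, ← AddCircle.coe_sub, AddCircle.coe_eq_zero_iff] at h
  obtain ⟨n, hn⟩ := h
  have hy : 2 * Real.pi * y = a.arg - n * (2 * Real.pi) := by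
    have := Real.pi_ne_zero
    simp only [zsmul_eq_mul, mul_one] at hn
    rw [hn]
    field_simp
    ring
  rw [hy]
  push_cast
  rw [sub_mul, mul_assoc (n : ℂ), Complex.exp_sub, Complex.exp_int_mul_two_pi_mul_I, div_one,
    Complex.norm_mul_exp_arg_mul_I]

/-- Divided by (s - t)², the product tends to d·e. -/
theorem eventually_mul_pos {b k : ℝ → ℝ} {d e t : ℝ} (hb : HasDerivAt b d t)
    (hk : HasDerivAt k e t) (hb0 : b t = 0) (hk0 : k t = 0) (hde : 0 < d * e) :
    ∀ᶠ s in 𝓝[≠] t, 0 < b s * k s := by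
  have h := (hasDerivAt_iff_tendsto_slope.1 hb).mul (hasDerivAt_iff_tendsto_slope.1 hk)
  filter_upwards [h.eventually (eventually_gt_nhds hde), self_mem_nhdsWithin] with s hs hst
  have hne : s - t ≠ 0 := sub_ne_zero.2 hst
  rw [slope_def_field, slope_def_field, hb0, hk0, sub_zero, sub_zero, div_mul_div_comm] at hs
  have hsq : 0 < (s - t) * (s - t) := mul_self_pos.2 hne
  exact (div_pos_iff_of_pos_right hsq).1 hs

theorem exists_strictMonoOn {h g : ℝ → ℝ} (hd : ∀ s, HasDerivAt h (g s) s) {t : ℝ}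
    (hg : ∀ᶠ s in 𝓝[≠] t, 0 < g s) :
    ∃ δ > 0, StrictMonoOn h (Set.Ioo (t - δ) (t + δ)) := by
  rw [eventually_nhdsWithin_iff, Metric.eventually_nhds_iff] at hg
  obtain ⟨δ, hδ, hg⟩ := hg
  have hpos (s : ℝ) (h1 : t - δ < s) (h2 : s < t + δ) (h3 : s ≠ t) : 0 < deriv h s := by
    rw [(hd s).deriv]
    exact hg (by rw [Real.dist_eq, abs_lt]; constructor <;> linarith) h3
  have hcont : Continuous h := continuous_iff_continuousAt.2 fun s => (hd s).continuousAt
  -- The derivative may vanish at t itself, so the two halves are treated separately and glued at t.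
  have m1 : StrictMonoOn h (Set.Ioc (t - δ) t) := by
    refine strictMonoOn_of_deriv_pos (convex_Ioc _ _) hcont.continuousOn fun s hs => ?_
    rw [interior_Ioc] at hs
    exact hpos s hs.1 (by linarith [hs.2]) hs.2.ne
  have m2 : StrictMonoOn h (Set.Ico t (t + δ)) := by
    refine strictMonoOn_of_deriv_pos (convex_Ico _ _) hcont.continuousOn fun s hs => ?_
    rw [interior_Ico] at hs
    exact hpos s (by linarith [hs.1]) hs.2 hs.1.ne'
  refine ⟨δ, hδ, ?_⟩
  have hu := m1.union m2 (c := t) ⟨⟨by linarith, le_rfl⟩, fun s hs => hs.2⟩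
    ⟨⟨le_rfl, by linarith⟩, fun s hs => hs.1⟩
  rwa [Set.Ioc_union_Ico_eq_Ioo (by linarith) (by linarith)] at hu

/-- The trivialization `frameMap` in polar coordinates. -/
theorem frameMap_polar {p : CC} {r s : ℝ} {u v : ℂ} (hr : r ≠ 0) (hs : s ≠ 0)
    (hu : u * (starRingEnd ℂ) u = 1) (hv : v * (starRingEnd ℂ) v = 1) (h0 : p 0 = r * u)
    (h1 : p 1 = s * v) (ξ η : ℝ) :
    frameMap p ((starRingEnd ℂ) (u * v) * (ξ + η * Complex.I)) 0 =
        s * u * (ξ - cosQuot p * η * Complex.I) ∧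
      frameMap p ((starRingEnd ℂ) (u * v) * (ξ + η * Complex.I)) 1 =
        -(r * v * (ξ + sinQuot p * η * Complex.I)) := by
  have hr' : (r : ℂ) ≠ 0 := by exact_mod_cast hr
  have hs' : (s : ℂ) ≠ 0 := by exact_mod_cast hs
  -- For a unit w, the phase in the frame coefficients is w². The factor conj(uv) in the argument
  -- cancels one power of it, leaving the polar frame.
  have q (w : ℂ) (a : ℂ) (ha : a ≠ 0) (hw : w * (starRingEnd ℂ) w = 1) :
      a * w / (a * (starRingEnd ℂ) w) = w * w := by
    have : (starRingEnd ℂ) w ≠ 0 := right_ne_zero_of_mul_eq_one hw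
    field_simp
    linear_combination -hw * w
  constructor
  · rw [frameMap_zero, frameCoeff₀, h0, h1]
    simp only [map_mul, Complex.conj_ofReal, q u r hr' hu, map_add, Complex.conj_conj,
      Complex.conj_I]
    push_cast
    linear_combination (1 / 2 * s * u * (1 - cosQuot p) * (ξ + η * Complex.I) * (u *
      (starRingEnd ℂ) u)) * hv + (1 / 2 * s * u * (1 - cosQuot p) * (ξ + η * Complex.I)) * hu +
      (1 / 2 * s * u * (1 + cosQuot p) * (ξ - η * Complex.I)) * hv
  · rw [frameMap_one, frameCoeff₁, h0, h1]
    simp only [map_mul, Complex.conj_ofReal, q v s hs' hv, map_add, Complex.conj_conj,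
      Complex.conj_I]
    push_cast
    linear_combination -(1 / 2 * r * v * (1 + sinQuot p) * (ξ + η * Complex.I) * (u *
      (starRingEnd ℂ) u)) * hv - (1 / 2 * r * v * (1 + sinQuot p) * (ξ + η * Complex.I)) * hu -
      (1 / 2 * r * v * (1 - sinQuot p) * (ξ - η * Complex.I)) * hu

theorem deriv_periodic_of_periodic {E : Type*} [NormedAddCommGroup E] [NormedSpace ℝ E]
    {f : ℝ → E} {c : ℝ} (h : Function.Periodic f c) : Function.Periodic (deriv f) c := by
  intro t
  rw [← deriv_comp_add_const]
  congr 1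
  ext1 s
  exact h s

/-! ### The velocity of the front -/

namespace LegendrianKnot

variable (K : LegendrianKnot)

/-- The `i`-th complex coordinate of the velocity divided by that of the knot. -/
def logDeriv (i : Fin 2) (t : ℝ) : ℂ := deriv K.toFun t i / K.toFun t i

/-- The derivative of the coordinate `y` along the knot. -/
def yDot (t : ℝ) : ℝ := (K.logDeriv 0 t).im / (2 * Real.pi)

/-- The derivative of the coordinate `z` along the knot. -/
def zDot (t : ℝ) : ℝ := (K.logDeriv 1 t).im / (2 * Real.pi)

/-- The angle `3πx/2` along the knot. -/
def theta (t : ℝ) : ℝ := 3 * Real.pi / 2 * ‖K.toFun t 0‖ ^ 2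

/-- The derivative of the coordinate `x` along the knot. -/
def xDot (t : ℝ) : ℝ := 2 * ((starRingEnd ℂ) (K.toFun t 0) * deriv K.toFun t 0).re

/-- The speed of the front, relative to its unit direction vector
`-(cos (3πx/2), sin (3πx/2))`. -/
def frontSpeed (t : ℝ) : ℝ :=
  -(K.yDot t * Real.cos (K.theta t) + K.zDot t * Real.sin (K.theta t))

theorem differentiable_toFun : Differentiable ℝ K.toFun := K.smooth.differentiable (by simp)

theorem contDiff_deriv : ContDiff ℝ ∞ (deriv K.toFun) := (contDiff_infty_iff_deriv.1 K.smooth).2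

theorem hasDerivAt_apply (i : Fin 2) (t : ℝ) :
    HasDerivAt (fun s => K.toFun s i) (deriv K.toFun t i) t :=
  (PiLp.proj 2 (𝕜 := ℝ) (fun _ : Fin 2 => ℂ) i).hasFDerivAt.comp_hasDerivAt t
    (K.differentiable_toFun t).hasDerivAt

theorem hasDerivAt_normSq (t : ℝ) : HasDerivAt (fun s => ‖K.toFun s 0‖ ^ 2) (K.xDot t) t := by
  have h := (K.hasDerivAt_apply 0 t).norm_sq
  refine h.congr_deriv ?_
  rw [xDot, Complex.inner]
  congr 2
  ring

theorem hasDerivAt_theta (t : ℝ) : HasDerivAt K.theta (3 * Real.pi / 2 * K.xDot t) t :=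
  (K.hasDerivAt_normSq t).const_mul _

theorem differentiable_logDeriv {i : Fin 2} (h : ∀ t, K.toFun t i ≠ 0) :
    Differentiable ℝ (K.logDeriv i) := by
  have h1 : Differentiable ℝ fun t => deriv K.toFun t i :=
    (PiLp.proj 2 (𝕜 := ℝ) (fun _ : Fin 2 => ℂ) i).differentiable.comp
      (K.contDiff_deriv.differentiable (by simp))
  have h2 : Differentiable ℝ fun t => K.toFun t i :=
    fun t => (K.hasDerivAt_apply i t).differentiableAt
  exact h1.div h2 h

variable {K}

theorem differentiable_frontSpeed (hK : ∀ t, K.toFun t 0 ≠ 0 ∧ K.toFun t 1 ≠ 0) :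
    Differentiable ℝ K.frontSpeed := by
  have h0 : Differentiable ℝ K.yDot :=
    (Complex.imCLM.differentiable.comp
      (K.differentiable_logDeriv fun t => (hK t).1)).div_const _
  have h1 : Differentiable ℝ K.zDot :=
    (Complex.imCLM.differentiable.comp
      (K.differentiable_logDeriv fun t => (hK t).2)).div_const _
  have h2 : Differentiable ℝ K.theta := fun t => (K.hasDerivAt_theta t).differentiableAt
  exact ((h0.mul h2.cos).add (h1.mul h2.sin)).neg

theorem conj_mul_deriv {i : Fin 2} {t : ℝ} (h : K.toFun t i ≠ 0) :
    (starRingEnd ℂ) (K.toFun t i) * deriv K.toFun t i =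
      (‖K.toFun t i‖ ^ 2 : ℝ) * K.logDeriv i t := by
  rw [logDeriv, Complex.sq_norm, ← Complex.mul_conj]
  field_simp

/-- The Legendrian condition in the coordinates y and z: the front velocity is orthogonal to ν,
hence a multiple of (cos θ, sin θ). -/
theorem sin_mul_yDot {t : ℝ} (hK : K.toFun t 0 ≠ 0 ∧ K.toFun t 1 ≠ 0) :
    Real.sin (K.theta t) * K.yDot t = Real.cos (K.theta t) * K.zDot t := by
  have h := (K.legendrian t).2
  have hpi := Real.pi_ne_zero
  rw [contactForm_eq_quot, conj_mul_deriv hK.1, conj_mul_deriv hK.2, Complex.im_ofReal_mul,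
    Complex.im_ofReal_mul, ← mul_assoc, ← mul_assoc, cosQuot_mul (K.mem_sphere t),
    sinQuot_mul, mul_eq_zero] at h
  rcases h with h | h
  · exact absurd h (by positivity)
  · simp only [yDot, zDot, theta]
    linear_combination (-1 / (2 * Real.pi)) * h

theorem yDot_eq {t : ℝ} (hK : K.toFun t 0 ≠ 0 ∧ K.toFun t 1 ≠ 0) :
    K.yDot t = -(K.frontSpeed t * Real.cos (K.theta t)) := by
  rw [frontSpeed]
  linear_combination (-K.yDot t) * Real.sin_sq_add_cos_sq (K.theta t) +
    Real.sin (K.theta t) * sin_mul_yDot hK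

theorem zDot_eq {t : ℝ} (hK : K.toFun t 0 ≠ 0 ∧ K.toFun t 1 ≠ 0) :
    K.zDot t = -(K.frontSpeed t * Real.sin (K.theta t)) := by
  rw [frontSpeed]
  linear_combination (-K.zDot t) * Real.sin_sq_add_cos_sq (K.theta t) -
    Real.cos (K.theta t) * sin_mul_yDot hK

theorem IsFrontLift.eq_polar {f : ℝ → ℝ × ℝ} (hf : K.IsFrontLift f) (t : ℝ) :
    K.toFun t 0 =
        ‖K.toFun t 0‖ * Complex.exp ((2 * Real.pi * (f t).1 : ℝ) * Complex.I) ∧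
      K.toFun t 1 =
        ‖K.toFun t 1‖ * Complex.exp ((2 * Real.pi * (f t).2 : ℝ) * Complex.I) := by
  have h := hf.2 t
  rw [front, torusProj, Prod.mk.injEq] at h
  exact ⟨eq_norm_mul_exp_of_coe_eq h.1, eq_norm_mul_exp_of_coe_eq h.2⟩

theorem IsFrontLift.hasDerivAt (hK : ∀ t, K.toFun t 0 ≠ 0 ∧ K.toFun t 1 ≠ 0) {f : ℝ → ℝ × ℝ}
    (hf : K.IsFrontLift f) (t : ℝ) :
    HasDerivAt (fun s => (f s).1) (-(K.frontSpeed t * Real.cos (K.theta t))) t ∧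
      HasDerivAt (fun s => (f s).2) (-(K.frontSpeed t * Real.sin (K.theta t))) t := by
  rw [← yDot_eq (hK t), ← zDot_eq (hK t)]
  exact ⟨hasDerivAt_angle (K.hasDerivAt_apply 0 t) (fun s => (hK s).1)
      (continuous_fst.comp hf.1) fun s => (hf.eq_polar s).1,
    hasDerivAt_angle (K.hasDerivAt_apply 1 t) (fun s => (hK s).2)
      (continuous_snd.comp hf.1) fun s => (hf.eq_polar s).2⟩

theorem IsFrontLift.deriv_eq (hK : ∀ t, K.toFun t 0 ≠ 0 ∧ K.toFun t 1 ≠ 0) {f : ℝ → ℝ × ℝ}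
    (hf : K.IsFrontLift f) : deriv f = fun t => (-(K.frontSpeed t * Real.cos (K.theta t)),
      -(K.frontSpeed t * Real.sin (K.theta t))) := by
  ext1 t
  exact ((hf.hasDerivAt hK t).1.prodMk (hf.hasDerivAt hK t).2).deriv

theorem IsFrontLift.deriv_eq_zero_iff (hK : ∀ t, K.toFun t 0 ≠ 0 ∧ K.toFun t 1 ≠ 0)
    {f : ℝ → ℝ × ℝ} (hf : K.IsFrontLift f) (t : ℝ) : deriv f t = 0 ↔ K.frontSpeed t = 0 := by
  rw [hf.deriv_eq hK, Prod.mk_eq_zero]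
  constructor
  · rintro ⟨h1, h2⟩
    linear_combination (-K.frontSpeed t) * Real.sin_sq_add_cos_sq (K.theta t) -
      Real.cos (K.theta t) * h1 - Real.sin (K.theta t) * h2
  · intro h
    simp [h]

/-! ### Cusps and their signs -/

/-- If b and b' both vanished, so would f'', against the independence of f'' and f''' at a cusp. -/
theorem deriv_frontSpeed_ne_zero (hK : K.InGeneralPosition) {f : ℝ → ℝ × ℝ}
    (hf : K.IsFrontLift f) {t : ℝ} (ht : K.frontSpeed t = 0) : deriv K.frontSpeed t ≠ 0 := by
  intro hb
  have hli := hK.2 f hf t ((hf.deriv_eq_zero_iff hK.1 t).2 ht)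
  refine hli.ne_zero 0 ?_
  have hs := (differentiable_frontSpeed hK.1 t).hasDerivAt
  rw [hb] at hs
  have hth := K.hasDerivAt_theta t
  have hd := ((hs.mul hth.cos).neg.prodMk (hs.mul hth.sin).neg).deriv
  rw [Matrix.cons_val_zero, iteratedDeriv_succ, iteratedDeriv_one, hf.deriv_eq hK.1]
  refine hd.trans ?_
  simp [ht]

theorem IsFrontLift.hasDerivAt_height (hK : ∀ t, K.toFun t 0 ≠ 0 ∧ K.toFun t 1 ≠ 0)
    {f : ℝ → ℝ × ℝ} (hf : K.IsFrontLift f) (t s : ℝ) :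
    HasDerivAt (fun s => K.height t (f s))
      (-(K.frontSpeed s * Real.sin (K.theta s - K.theta t))) s := by
  have h := ((hf.hasDerivAt hK s).1.const_mul (-Real.sin (K.theta t))).add
    ((hf.hasDerivAt hK s).2.const_mul (Real.cos (K.theta t)))
  refine h.congr_deriv ?_
  rw [Real.sin_sub]
  ring

theorem not_strictMonoOn_and_strictAntiOn {h : ℝ → ℝ} {t δ δ' : ℝ} (hδ : 0 < δ) (hδ' : 0 < δ')
    (h1 : StrictMonoOn h (Set.Ioo (t - δ) (t + δ)))
    (h2 : StrictAntiOn h (Set.Ioo (t - δ') (t + δ'))) : False := by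
  obtain ⟨s, hs, hs'⟩ := exists_between (lt_min hδ hδ')
  rw [lt_min_iff] at hs'
  have a := h1 (a := t) (b := t + s) ⟨by linarith, by linarith⟩ ⟨by linarith, by linarith⟩
    (by linarith)
  have b := h2 (a := t) (b := t + s) ⟨by linarith, by linarith⟩ ⟨by linarith, by linarith⟩
    (by linarith)
  linarith

theorem hasDerivAt_sin_theta_sub (t : ℝ) :
    HasDerivAt (fun s => Real.sin (K.theta s - K.theta t)) (3 * Real.pi / 2 * K.xDot t) t := by
  have h := ((K.hasDerivAt_theta t).sub_const (K.theta t)).sin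
  simpa using h

/-- The height derivative -b(s) sin(θ(s) - θ(t)) is a product of two functions with simple zeros at
t. It thus has constant sign on both sides, that of -b'x'. -/
theorem IsFrontLift.exists_strictMonoOn_height (hK : ∀ t, K.toFun t 0 ≠ 0 ∧ K.toFun t 1 ≠ 0)
    {f : ℝ → ℝ × ℝ} (hf : K.IsFrontLift f) {t : ℝ} (ht : K.frontSpeed t = 0)
    (hneg : deriv K.frontSpeed t * K.xDot t < 0) :
    ∃ δ > 0, StrictMonoOn (fun s => K.height t (f s)) (Set.Ioo (t - δ) (t + δ)) := by
  refine exists_strictMonoOn (hf.hasDerivAt_height hK t) ?_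
  have h := eventually_mul_pos (differentiable_frontSpeed hK t).hasDerivAt.neg
    (hasDerivAt_sin_theta_sub t) (by simp [ht]) (by simp)
    (by
      rw [show -deriv K.frontSpeed t * (3 * Real.pi / 2 * K.xDot t) =
        3 * Real.pi / 2 * -(deriv K.frontSpeed t * K.xDot t) by ring]
      exact mul_pos (by positivity) (neg_pos.2 hneg))
  filter_upwards [h] with s hs
  simpa using hs

theorem IsFrontLift.exists_strictAntiOn_height (hK : ∀ t, K.toFun t 0 ≠ 0 ∧ K.toFun t 1 ≠ 0)
    {f : ℝ → ℝ × ℝ} (hf : K.IsFrontLift f) {t : ℝ} (ht : K.frontSpeed t = 0)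
    (hpos : 0 < deriv K.frontSpeed t * K.xDot t) :
    ∃ δ > 0, StrictAntiOn (fun s => K.height t (f s)) (Set.Ioo (t - δ) (t + δ)) := by
  have h := eventually_mul_pos (differentiable_frontSpeed hK t).hasDerivAt
    (hasDerivAt_sin_theta_sub t) ht (by simp)
    (by
      rw [mul_left_comm]
      exact mul_pos (by positivity) hpos)
  obtain ⟨δ, hδ, hm⟩ := exists_strictMonoOn (t := t)
    (fun s => (hf.hasDerivAt_height hK t s).neg) (by simpa using h)
  exact ⟨δ, hδ, fun a ha b hb hab => neg_lt_neg_iff.1 (hm ha hb hab)⟩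

/-- The sign of a cusp, and `0` if there is no cusp. -/
def cuspSign (K : LegendrianKnot) (t : ℝ) : ℤ :=
  if K.frontSpeed t = 0 then SignType.sign (deriv K.frontSpeed t * K.xDot t) else 0

theorem isDescendingCusp_iff (hK : ∀ t, K.toFun t 0 ≠ 0 ∧ K.toFun t 1 ≠ 0)
    {f : ℝ → ℝ × ℝ} (hf : K.IsFrontLift f)
    (hne : ∀ t, K.frontSpeed t = 0 → deriv K.frontSpeed t * K.xDot t ≠ 0) (t : ℝ) :
    K.IsDescendingCusp t ↔ K.cuspSign t = 1 := by
  constructor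
  · rintro ⟨f', hf', h0, δ, hδ, hm⟩
    have ht := (hf'.deriv_eq_zero_iff hK t).1 h0
    rw [cuspSign, if_pos ht]
    rcases (hne t ht).lt_or_gt with h | h
    · obtain ⟨δ', hδ', hm'⟩ := hf'.exists_strictMonoOn_height hK ht h
      exact (not_strictMonoOn_and_strictAntiOn hδ' hδ hm' hm).elim
    · rw [sign_pos h]; rfl
  · intro h
    have ht : K.frontSpeed t = 0 := by
      by_contra hcon
      simp [cuspSign, hcon] at h
    rw [cuspSign, if_pos ht] at h
    refine ⟨f, hf, (hf.deriv_eq_zero_iff hK t).2 ht, hf.exists_strictAntiOn_height hK ht ?_⟩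
    rcases (hne t ht).lt_or_gt with h' | h'
    · rw [sign_neg h'] at h; norm_num at h
    · exact h'

theorem isAscendingCusp_iff (hK : ∀ t, K.toFun t 0 ≠ 0 ∧ K.toFun t 1 ≠ 0)
    {f : ℝ → ℝ × ℝ} (hf : K.IsFrontLift f)
    (hne : ∀ t, K.frontSpeed t = 0 → deriv K.frontSpeed t * K.xDot t ≠ 0) (t : ℝ) :
    K.IsAscendingCusp t ↔ K.cuspSign t = -1 := by
  constructor
  · rintro ⟨f', hf', h0, δ, hδ, hm⟩
    have ht := (hf'.deriv_eq_zero_iff hK t).1 h0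
    rw [cuspSign, if_pos ht]
    rcases (hne t ht).lt_or_gt with h | h
    · rw [sign_neg h]; rfl
    · obtain ⟨δ', hδ', hm'⟩ := hf'.exists_strictAntiOn_height hK ht h
      exact (not_strictMonoOn_and_strictAntiOn hδ hδ' hm hm').elim
  · intro h
    have ht : K.frontSpeed t = 0 := by
      by_contra hcon
      simp [cuspSign, hcon] at h
    rw [cuspSign, if_pos ht] at h
    refine ⟨f, hf, (hf.deriv_eq_zero_iff hK t).2 ht, hf.exists_strictMonoOn_height hK ht ?_⟩
    rcases (hne t ht).lt_or_gt with h' | h'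
    · exact h'
    · rw [sign_pos h'] at h; norm_num at h

theorem cuspSign_periodic (K : LegendrianKnot) : Function.Periodic K.cuspSign 1 := by
  have h1 := deriv_periodic_of_periodic K.periodic
  have h2 : Function.Periodic K.frontSpeed 1 := by
    intro t
    simp only [frontSpeed, yDot, zDot, theta, logDeriv, h1 t, K.periodic t]
  have h3 := deriv_periodic_of_periodic h2
  intro t
  simp only [cuspSign, xDot, h1 t, h2 t, h3 t, K.periodic t]

/-! ### Comparison with the global frame -/

/-- The velocity of the knot in the global trivialization of the contact structure. -/
theorem IsFrontLift.frameCoord_eq (hK : ∀ t, K.toFun t 0 ≠ 0 ∧ K.toFun t 1 ≠ 0)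
    {f : ℝ → ℝ × ℝ} (hf : K.IsFrontLift f) (t : ℝ) :
    Complex.exp ((2 * Real.pi * ((f t).1 + (f t).2) : ℝ) * Complex.I) *
      frameCoord (K.toFun t) (deriv K.toFun t) =
      (K.xDot t / (2 * (‖K.toFun t 0‖ * ‖K.toFun t 1‖)) : ℝ) +
      (2 * Real.pi * (‖K.toFun t 0‖ * ‖K.toFun t 1‖) * K.frontSpeed t : ℝ) * Complex.I := by
  have hr : ‖K.toFun t 0‖ ≠ 0 := norm_ne_zero_iff.2 (hK t).1
  have hs : ‖K.toFun t 1‖ ≠ 0 := norm_ne_zero_iff.2 (hK t).2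
  obtain ⟨e0, e1⟩ := hf.eq_polar t
  have unit (x : ℝ) : Complex.exp (x * Complex.I) *
      (starRingEnd ℂ) (Complex.exp (x * Complex.I)) = 1 := by
    rw [Complex.mul_conj, Complex.normSq_eq_norm_sq, Complex.norm_exp_ofReal_mul_I]; simp
  have hu := unit (2 * Real.pi * (f t).1)
  have hv := unit (2 * Real.pi * (f t).2)
  have huv : Complex.exp ((2 * Real.pi * ((f t).1 + (f t).2) : ℝ) * Complex.I) =
      Complex.exp ((2 * Real.pi * (f t).1 : ℝ) * Complex.I) *
        Complex.exp ((2 * Real.pi * (f t).2 : ℝ) * Complex.I) := by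
    rw [← Complex.exp_add]; push_cast; ring_nf
  rw [huv]
  generalize Complex.exp ((2 * Real.pi * (f t).1 : ℝ) * Complex.I) = u at *
  generalize Complex.exp ((2 * Real.pi * (f t).2 : ℝ) * Complex.I) = v at *
  set ξ : ℝ := K.xDot t / (2 * (‖K.toFun t 0‖ * ‖K.toFun t 1‖)) with hξ
  set η : ℝ := 2 * Real.pi * (‖K.toFun t 0‖ * ‖K.toFun t 1‖) * K.frontSpeed t with hη
  obtain ⟨m0, m1⟩ := frameMap_polar hr hs hu hv e0 e1 ξ η
  have hpi := Real.pi_ne_zero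
  have re0 : (K.logDeriv 0 t).re * ‖K.toFun t 0‖ ^ 2 = K.xDot t / 2 := by
    rw [xDot, conj_mul_deriv (hK t).1, Complex.re_ofReal_mul]; ring
  -- Tangency to the sphere: ‖p 1‖² = 1 - x changes at the rate -x'.
  have re1 : (K.logDeriv 1 t).re * ‖K.toFun t 1‖ ^ 2 = -(K.xDot t / 2) := by
    have h := (K.legendrian t).1
    rw [inner_CC, conj_mul_deriv (hK t).2, Complex.re_ofReal_mul] at h
    rw [xDot]
    linear_combination h
  have im0 : (K.logDeriv 0 t).im =
      -(2 * Real.pi * K.frontSpeed t * (cosQuot (K.toFun t) * ‖K.toFun t 1‖ ^ 2)) := by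
    have h := yDot_eq (hK t)
    rw [theta, ← cosQuot_mul (K.mem_sphere t), yDot, div_eq_iff (by positivity)] at h
    rw [h]; ring
  have im1 : (K.logDeriv 1 t).im =
      -(2 * Real.pi * K.frontSpeed t * (sinQuot (K.toFun t) * ‖K.toFun t 0‖ ^ 2)) := by
    have h := zDot_eq (hK t)
    rw [theta, ← sinQuot_mul (K.toFun t), zDot, div_eq_iff (by positivity)] at h
    rw [h]; ring
  have d (i : Fin 2) : deriv K.toFun t i = K.toFun t i * K.logDeriv i t := by
    rw [logDeriv, mul_div_cancel₀]
    fin_cases i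
    · exact (hK t).1
    · exact (hK t).2
  have key : deriv K.toFun t =
      frameMap (K.toFun t) ((starRingEnd ℂ) (u * v) * (ξ + η * Complex.I)) := by
    ext i
    fin_cases i
    · change deriv K.toFun t 0 = frameMap _ _ 0
      rw [m0, d 0]
      conv_lhs => rw [e0]
      have : (‖K.toFun t 0‖ : ℂ) * K.logDeriv 0 t =
          ‖K.toFun t 1‖ * (ξ - cosQuot (K.toFun t) * η * Complex.I) := by
        apply Complex.ext
        · simp only [Complex.re_ofReal_mul]
          simp
          rw [hξ]
          field_simp
          linear_combination 2 * re0
        · simp only [Complex.im_ofReal_mul]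
          simp
          rw [hη, im0]
          ring
      linear_combination u * this
    · change deriv K.toFun t 1 = frameMap _ _ 1
      rw [m1, d 1]
      conv_lhs => rw [e1]
      have : (‖K.toFun t 1‖ : ℂ) * K.logDeriv 1 t =
          -(‖K.toFun t 0‖ * (ξ + sinQuot (K.toFun t) * η * Complex.I)) := by
        apply Complex.ext
        · simp only [Complex.re_ofReal_mul, Complex.neg_re]
          simp
          rw [hξ]
          field_simp
          linear_combination 2 * re1
        · simp only [Complex.im_ofReal_mul, Complex.neg_im]
          simp
          rw [hη, im1]
          ring
      linear_combination v * this
  rw [key, frameCoord_frameMap (K.mem_sphere t), ← mul_assoc, Complex.mul_conj,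
    Complex.normSq_eq_norm_sq]
  have nu : ‖u * v‖ = 1 := by
    have h2 : (u * v) * (starRingEnd ℂ) (u * v) = 1 := by
      rw [map_mul]; linear_combination (v * (starRingEnd ℂ) v) * hu + hv
    rw [Complex.mul_conj, Complex.normSq_eq_norm_sq] at h2
    have h3 : ‖u * v‖ ^ 2 = 1 := by exact_mod_cast h2
    nlinarith [norm_nonneg (u * v)]
  rw [nu]
  simp

end LegendrianKnot

/-! ### Existence of the rotation number and independence of the parallelization -/

/-- A continuous nowhere vanishing function on the sphere has winding number zero along a closed
curve which misses a point. -/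
theorem exists_closed_angle {g : S3 → ℂ} (hg : Continuous g) (h0 : ∀ p, g p ≠ 0) {k : ℝ → S3}
    (hk : Continuous k) (hper : k 1 = k 0) {q : CC} (hq : ‖q‖ = 1) (hkq : ∀ t, (k t : CC) ≠ q) :
    ∃ ψ : ℝ → ℝ, Continuous ψ ∧ ψ 1 = ψ 0 ∧
      ∀ t, g (k t) = ‖g (k t)‖ * Complex.exp (ψ t * Complex.I) := by
  -- Stereographic projection from q makes the sphere minus q a vector space. There g has a
  -- single-valued angle, which returns to its initial value along the closed curve.
  obtain ⟨φ, hφ, h⟩ := exists_continuous_angle (hg.comp (continuous_stereoInvFun hq))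
    fun w => h0 _
  refine ⟨fun t => φ (stereoToFun q (k t)), hφ.comp ?_, ?_, fun t => ?_⟩
  · refine continuousOn_univ.1 ((continuousOn_stereoToFun (v := q)).comp
      (continuous_subtype_val.comp hk).continuousOn fun t _ => ?_)
    intro h1
    refine hkq t ?_
    have h1' : inner ℝ q (k t : CC) = (1 : ℝ) := h1
    exact ((inner_eq_one_iff_of_norm_eq_one (𝕜 := ℝ) hq
      (mem_sphere_zero_iff_norm.1 (k t).2)).1 h1').symm
  · simp only [hper]
  · have := h (stereoToFun q (k t))
    simp only [Function.comp_apply] at this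
    rwa [stereo_left_inv hq (hkq t)] at this

theorem exists_int_of_exp_eq {x y : ℝ}
    (h : Complex.exp (x * Complex.I) = Complex.exp (y * Complex.I)) :
    ∃ n : ℤ, x = y + 2 * Real.pi * n := by
  obtain ⟨n, hn⟩ := Complex.exp_eq_exp_iff_exists_int.1 h
  refine ⟨n, ?_⟩
  have := congrArg Complex.im hn
  simp at this
  linarith

theorem exp_eq_of_pos_mul_eq {a b : ℝ} (ha : 0 < a) (hb : 0 < b) {x y : ℝ}
    (h : (a : ℂ) * Complex.exp (x * Complex.I) = b * Complex.exp (y * Complex.I)) :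
    Complex.exp (x * Complex.I) = Complex.exp (y * Complex.I) := by
  have h1 := congrArg norm h
  rw [norm_mul, norm_mul, Complex.norm_exp_ofReal_mul_I, Complex.norm_exp_ofReal_mul_I,
    Complex.norm_of_nonneg ha.le, Complex.norm_of_nonneg hb.le, mul_one, mul_one] at h1
  rw [h1] at h
  exact mul_left_cancel₀ (by exact_mod_cast hb.ne') h

namespace LegendrianKnot

theorem exists_coefficients (K : LegendrianKnot) (P : Parallelization) :
    ∃ A B : ℝ → ℝ, Continuous A ∧ Continuous B ∧ A 1 = A 0 ∧ B 1 = B 0 ∧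
      ∀ t, deriv K.toFun t = A t • P.e₁ ⟨K.toFun t, K.mem_sphere t⟩ +
        B t • P.e₂ ⟨K.toFun t, K.mem_sphere t⟩ := by
  obtain ⟨k, hkdef⟩ : ∃ k : ℝ → S3, ∀ t, k t = ⟨K.toFun t, K.mem_sphere t⟩ := ⟨_, fun _ => rfl⟩
  have hkK (t : ℝ) : (k t : CC) = K.toFun t := by rw [hkdef]
  have hK : Continuous K.toFun := K.smooth.continuous
  have hk : Continuous k := by
    rw [funext hkdef]
    exact hK.subtype_mk _
  have hK' : Continuous (deriv K.toFun) := K.contDiff_deriv.continuous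
  have h1 : Continuous fun t => P.e₁ (k t) := P.continuous₁.comp hk
  have h2 : Continuous fun t => P.e₂ (k t) := P.continuous₂.comp hk
  have hpos (t : ℝ) : 0 < dContactForm (K.toFun t) (P.e₁ (k t)) (P.e₂ (k t)) := by
    have := P.positive (k t)
    rwa [hkK] at this
  have hper' : deriv K.toFun 1 = deriv K.toFun 0 := by
    simpa using deriv_periodic_of_periodic K.periodic 0
  have hper0 : K.toFun 1 = K.toFun 0 := by simpa using K.periodic 0
  have hper : k 1 = k 0 := Subtype.ext (by rw [hkK, hkK, hper0])
  refine ⟨_, _, (continuous_dContactForm hK hK' h2).div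
    (continuous_dContactForm hK h1 h2) fun t => (hpos t).ne',
    (continuous_dContactForm hK h1 hK').div (continuous_dContactForm hK h1 h2)
      fun t => (hpos t).ne', ?_, ?_, fun t => ?_⟩
  · simp only [Pi.div_apply, hper, hper0, hper']
  · simp only [Pi.div_apply, hper, hper0, hper']
  · rw [← hkdef]
    have m1 := P.mem₁ (k t)
    have m2 := P.mem₂ (k t)
    rw [hkK] at m1 m2
    exact eq_combination (K.mem_sphere t) m1 m2 (K.legendrian t) (hpos t).ne'

theorem exists_hasRotation (K : LegendrianKnot) (P : Parallelization) :
    ∃ r : ℤ, K.HasRotation P r := by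
  obtain ⟨A, B, hA, hB, hA1, hB1, hcomb⟩ := K.exists_coefficients P
  -- The coefficients cannot both vanish because the knot is immersed, so their angle lifts;
  -- periodicity makes its increment a multiple of 2π.
  have hne (t : ℝ) : ((A t : ℂ) + B t * Complex.I) ≠ 0 := by
    intro h
    have hre := congrArg Complex.re h
    have him := congrArg Complex.im h
    simp at hre him
    exact K.immersion t (by rw [hcomb t, hre, him]; simp)
  obtain ⟨φ, hφ, h⟩ := exists_continuous_angle (g := fun t => (A t : ℂ) + B t * Complex.I)
    (by fun_prop) hne
  obtain ⟨r, hr⟩ : ∃ n : ℤ, φ 1 = φ 0 + 2 * Real.pi * n := by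
    apply exists_int_of_exp_eq
    refine exp_eq_of_pos_mul_eq (norm_pos_iff.2 (hne 1)) (norm_pos_iff.2 (hne 0)) ?_
    rw [← h, ← h, hA1, hB1]
  refine ⟨r, φ, fun t => ‖(A t : ℂ) + B t * Complex.I‖, hφ, fun t => norm_pos_iff.2 (hne t),
    fun t => ?_, hr⟩
  have ht := h t
  rw [Complex.exp_mul_I, ← Complex.ofReal_cos, ← Complex.ofReal_sin] at ht
  have hre := congrArg Complex.re ht
  have him := congrArg Complex.im ht
  rw [Complex.re_ofReal_mul] at hre
  rw [Complex.im_ofReal_mul] at him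
  simp only [Complex.add_re, Complex.add_im, Complex.ofReal_re, Complex.ofReal_im, Complex.mul_re,
    Complex.mul_im, Complex.I_re, Complex.I_im, mul_zero, mul_one, sub_zero, add_zero,
    zero_add] at hre him
  rw [smul_add, smul_smul, smul_smul, ← hre, ← him]
  exact hcomb t

/-- The number of revolutions of the velocity in the global trivialization does not depend on the
parallelization used to define the rotation number. -/
theorem HasRotation.frameCoord_angle {K : LegendrianKnot} {P : Parallelization} {r : ℤ}
    (hr : K.HasRotation P r) {q : CC} (hq : ‖q‖ = 1) (hKq : ∀ t, K.toFun t ≠ q) :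
    ∃ φ : ℝ → ℝ, Continuous φ ∧ φ 1 = φ 0 + 2 * Real.pi * r ∧
      ∀ t, ∃ ρ : ℝ, 0 < ρ ∧
        frameCoord (K.toFun t) (deriv K.toFun t) = ρ * Complex.exp (φ t * Complex.I) := by
  obtain ⟨φ, ρ, hφ, hρ, hd, hinc⟩ := hr
  let k : ℝ → S3 := fun t => ⟨K.toFun t, K.mem_sphere t⟩
  have hk : Continuous k := K.smooth.continuous.subtype_mk _
  have hper : k 1 = k 0 := Subtype.ext (by simpa using K.periodic 0)
  let g : S3 → ℂ := fun p => frameCoord p (P.e₁ p)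
  let h : S3 → ℂ := fun p => frameCoord p (P.e₂ p)
  have hg : Continuous g := continuous_frameCoord continuous_id P.continuous₁
  have hh : Continuous h := continuous_frameCoord continuous_id P.continuous₂
  have hpos (p : S3) : 0 < ((starRingEnd ℂ) (g p) * h p).im := by
    have := P.positive p
    rw [← frameMap_frameCoord p.2 (P.mem₁ p), ← frameMap_frameCoord p.2 (P.mem₂ p),
      dContactForm_frameMap p.2] at this
    simp only [g, h]
    linarith
  have hg0 (p : S3) : g p ≠ 0 := by
    intro h0
    have := hpos p
    rw [h0] at this
    simp at this
  have hm (p : S3) : 0 < (h p / g p).im := by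
    have : h p / g p = ((Complex.normSq (g p))⁻¹ : ℝ) * ((starRingEnd ℂ) (g p) * h p) := by
      rw [div_eq_mul_inv, Complex.inv_def]; ring
    rw [this, Complex.im_ofReal_mul]
    exact mul_pos (inv_pos.2 (Complex.normSq_pos.2 (hg0 p))) (hpos p)
  obtain ⟨ψ, hψ, hψ1, hgψ⟩ := exists_closed_angle hg hg0 hk hper hq hKq
  -- The discrepancy between the frame P and an orthonormal one (where h/g = i and w = 1). It stays
  -- in the slit plane, so its principal argument is continuous; since w 1 = w 0, it adds no turns.
  -- The total angle is then that of g, plus φ, plus arg w.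
  let w : ℝ → ℂ := fun t => ((Real.cos (φ t) : ℂ) + Real.sin (φ t) * (h (k t) / g (k t))) *
    Complex.exp (-(φ t * Complex.I))
  have hw (t : ℝ) : w t ∈ Complex.slitPlane := slitPlane_of_im_pos (hm (k t)) (φ t)
  have hwc : Continuous w := by
    have : Continuous fun t => h (k t) / g (k t) :=
      (hh.comp hk).div (hg.comp hk) fun t => hg0 _
    fun_prop
  have hw1 : w 1 = w 0 := by
    have e1 : Complex.exp (-(φ 1 * Complex.I)) = Complex.exp (-(φ 0 * Complex.I)) := by
      rw [Complex.exp_eq_exp_iff_exists_int]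
      refine ⟨-r, ?_⟩
      rw [hinc]; push_cast; ring
    have e2 : Real.cos (φ 1) = Real.cos (φ 0) := by
      rw [hinc, mul_comm (2 * Real.pi), Real.cos_add_int_mul_two_pi]
    have e3 : Real.sin (φ 1) = Real.sin (φ 0) := by
      rw [hinc, mul_comm (2 * Real.pi), Real.sin_add_int_mul_two_pi]
    simp only [w, e1, e2, e3, hper]
  refine ⟨fun t => ψ t + φ t + (w t).arg, ?_, ?_, fun t => ?_⟩
  · have : Continuous fun t => (w t).arg := continuous_iff_continuousAt.2 fun t =>
      (Complex.continuousAt_arg (hw t)).comp hwc.continuousAt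
    exact (hψ.add hφ).add this
  · simp only [hψ1, hw1, hinc]; ring
  · have hw0 : w t ≠ 0 := Complex.slitPlane_ne_zero (hw t)
    refine ⟨ρ t * (‖g (k t)‖ * ‖w t‖), mul_pos (hρ t) (mul_pos (norm_pos_iff.2 (hg0 _))
      (norm_pos_iff.2 hw0)), ?_⟩
    have hζ : deriv K.toFun t = frameMap (K.toFun t)
        ((ρ t : ℂ) * ((Real.cos (φ t) : ℂ) * g (k t) + (Real.sin (φ t) : ℂ) * h (k t))) := by
      rw [frameMap_ofReal_mul, frameMap_add, frameMap_ofReal_mul, frameMap_ofReal_mul,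
        frameMap_frameCoord (K.mem_sphere t) (P.mem₁ (k t)),
        frameMap_frameCoord (K.mem_sphere t) (P.mem₂ (k t))]
      exact hd t
    rw [hζ, frameCoord_frameMap (K.mem_sphere t)]
    have hexp : w t * Complex.exp (φ t * Complex.I) =
        (Real.cos (φ t) : ℂ) + Real.sin (φ t) * (h (k t) / g (k t)) := by
      simp only [w]
      rw [mul_assoc, ← Complex.exp_add, neg_add_cancel, Complex.exp_zero, mul_one]
    have hsplit : Complex.exp ((ψ t + φ t + (w t).arg : ℝ) * Complex.I) =
        Complex.exp (ψ t * Complex.I) * Complex.exp (φ t * Complex.I) *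
          Complex.exp ((w t).arg * Complex.I) := by
      rw [← Complex.exp_add, ← Complex.exp_add]; push_cast; ring_nf
    rw [hsplit]
    have hwn := Complex.norm_mul_exp_arg_mul_I (w t)
    have hgn := hgψ t
    have hfinal : (Real.cos (φ t) : ℂ) * g (k t) + (Real.sin (φ t) : ℂ) * h (k t) =
        g (k t) * (w t * Complex.exp (φ t * Complex.I)) := by
      rw [hexp]
      field_simp [hg0 (k t)]
    rw [hfinal]
    push_cast
    linear_combination (ρ t * Complex.exp (φ t * Complex.I) * w t) * hgn -
      (ρ t * Complex.exp (φ t * Complex.I) * ‖g (k t)‖ * Complex.exp (ψ t * Complex.I)) * hwn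

/-! ### The rotation formula -/

theorem two_mul_rotation_eq {K : LegendrianKnot} {P : Parallelization} {r : ℤ}
    (hr : K.HasRotation P r) (hK : K.InGeneralPosition) {a b : ℤ} (hab : K.HasFrontClass a b) :
    2 * (r + a + b) = (K.cuspPos : ℤ) - K.cuspNeg := by
  obtain ⟨f, hf, hf1⟩ := hab
  have hn (t : ℝ) (i : Fin 2) : 0 < ‖K.toFun t i‖ := by
    fin_cases i
    · exact norm_pos_iff.2 (hK.1 t).1
    · exact norm_pos_iff.2 (hK.1 t).2
  -- The missed point is taken on the core circle x = 0.
  have hq : ‖(EuclideanSpace.single 1 1 : CC)‖ = 1 := by simp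
  have hKq (t : ℝ) : K.toFun t ≠ EuclideanSpace.single 1 1 := fun h =>
    (hK.1 t).1 (by rw [h]; simp)
  obtain ⟨φ, hφ, hinc, hang⟩ := hr.frameCoord_angle hq hKq
  have hfc := hf.1
  have hcusp : ∀ t, K.frontSpeed t = 0 → deriv K.frontSpeed t * K.xDot t ≠ 0 := by
    intro t ht
    -- If x' also vanished at a cusp, the velocity would be zero in the global frame, which its
    -- polar form with ρ > 0 excludes.
    refine mul_ne_zero (deriv_frontSpeed_ne_zero hK hf ht) fun hx => ?_
    have h := hf.frameCoord_eq hK.1 t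
    obtain ⟨ρ, hρ, e⟩ := hang t
    rw [ht, hx, e] at h
    simp [hρ.ne'] at h
  -- The angle of the rescaled x' + ib. It makes r + a + b turns, and sin Φ vanishes exactly at the
  -- cusps.
  let Φ : ℝ → ℝ := fun t => φ t + 2 * Real.pi * ((f t).1 + (f t).2)
  have hΦ : Continuous Φ := by fun_prop
  have hpolar (t : ℝ) : ∃ ρ : ℝ, 0 < ρ ∧
      K.xDot t / (2 * (‖K.toFun t 0‖ * ‖K.toFun t 1‖)) = ρ * Real.cos (Φ t) ∧
      2 * Real.pi * (‖K.toFun t 0‖ * ‖K.toFun t 1‖) * K.frontSpeed t = ρ * Real.sin (Φ t) := by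
    obtain ⟨ρ, hρ, e⟩ := hang t
    refine ⟨ρ, hρ, ?_⟩
    have h := hf.frameCoord_eq hK.1 t
    rw [e, mul_left_comm, ← Complex.exp_add, ← add_mul, ← Complex.ofReal_add, add_comm,
      Complex.exp_mul_I, ← Complex.ofReal_cos, ← Complex.ofReal_sin] at h
    have hre := congrArg Complex.re h
    have him := congrArg Complex.im h
    rw [Complex.re_ofReal_mul] at hre
    rw [Complex.im_ofReal_mul] at him
    simp only [Complex.add_re, Complex.add_im, Complex.ofReal_re, Complex.ofReal_im,
      Complex.mul_re, Complex.mul_im, Complex.I_re, Complex.I_im, mul_zero, mul_one, sub_zero,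
      add_zero, zero_add] at hre him
    exact ⟨hre.symm, him.symm⟩
  have hsin (t : ℝ) : Real.sin (Φ t) = 0 ↔ K.frontSpeed t = 0 := by
    obtain ⟨ρ, hρ, -, e⟩ := hpolar t
    have h1 : 0 < 2 * Real.pi * (‖K.toFun t 0‖ * ‖K.toFun t 1‖) :=
      mul_pos (by positivity) (mul_pos (hn t 0) (hn t 1))
    constructor
    · intro h
      rw [h, mul_zero] at e
      exact (mul_eq_zero.1 e).resolve_left h1.ne'
    · intro h
      rw [h, mul_zero] at e
      exact (mul_eq_zero.1 e.symm).resolve_left hρ.ne'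
  have hsign (x : ℝ) : (SignType.sign x : ℤ) = 1 ∨ (SignType.sign x : ℤ) = 0 ∨
      (SignType.sign x : ℤ) = -1 := by
    rcases lt_trichotomy x 0 with h | h | h
    · simp [sign_neg h]
    · simp [h]
    · simp [sign_pos h]
  have hε (t : ℝ) : K.cuspSign t = 1 ∨ K.cuspSign t = 0 ∨ K.cuspSign t = -1 := by
    rw [cuspSign]
    split_ifs
    · exact hsign _
    · simp
  have key := two_mul_turns_eq hΦ hε (fun t ht => if_neg fun h => ht ((hsin t).2 h))
    (fun t ht => ?_) (by simpa using K.cuspSign_periodic 0) (r := r + a + b) ?_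
  · rw [key, cuspPos, cuspNeg]
    simp only [isDescendingCusp_iff hK.1 hf hcusp, isAscendingCusp_iff hK.1 hf hcusp]
  · have hb0 := (hsin t).1 ht
    have hb := (differentiable_frontSpeed hK.1 t).hasDerivAt
    have hk : HasDerivAt (fun s => (K.cuspSign t : ℝ) * K.xDot t * (s - t))
        ((K.cuspSign t : ℝ) * K.xDot t) t := by
      simpa using ((hasDerivAt_id t).sub_const t).const_mul ((K.cuspSign t : ℝ) * K.xDot t)
    have hpos : 0 < deriv K.frontSpeed t * ((K.cuspSign t : ℝ) * K.xDot t) := by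
      rw [mul_left_comm, cuspSign, if_pos hb0]
      rcases (hcusp t hb0).lt_or_gt with h | h
      · rw [sign_neg h]; simpa using h
      · rw [sign_pos h]; simpa using h
    filter_upwards [eventually_mul_pos hb hk hb0 (by simp) hpos] with s hs
    obtain ⟨ρ, hρ, ec, es⟩ := hpolar t
    obtain ⟨ρ', hρ', ec', es'⟩ := hpolar s
    have nt := mul_pos (hn t 0) (hn t 1)
    have ns := mul_pos (hn s 0) (hn s 1)
    -- As sin Φ(t) = 0, only sin Φ(s) cos Φ(t) survives, a positive multiple of b(s)x'(t). So Φ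
    -- crosses the multiple of π in the direction of the sign of b'x'.
    have hst : Real.sin (Φ s - Φ t) * (ρ * ρ') = K.frontSpeed s * K.xDot t *
        (Real.pi * (‖K.toFun s 0‖ * ‖K.toFun s 1‖) / (‖K.toFun t 0‖ * ‖K.toFun t 1‖)) := by
      have : Real.sin (Φ s - Φ t) * (ρ * ρ') =
          (ρ' * Real.sin (Φ s)) * (ρ * Real.cos (Φ t)) := by
        rw [Real.sin_sub, ht]; ring
      rw [this, ← es', ← ec]
      field_simp
    have hρρ := mul_pos hρ hρ'
    refine pos_of_mul_pos_left (b := ρ * ρ') ?_ hρρ.le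
    have hfac : 0 < Real.pi * (‖K.toFun s 0‖ * ‖K.toFun s 1‖) /
        (‖K.toFun t 0‖ * ‖K.toFun t 1‖) := div_pos (mul_pos Real.pi_pos ns) nt
    have heq : (K.cuspSign t : ℝ) * (Real.sin (Φ s - Φ t) * (s - t)) * (ρ * ρ') =
        K.frontSpeed s * ((K.cuspSign t : ℝ) * K.xDot t * (s - t)) *
        (Real.pi * (‖K.toFun s 0‖ * ‖K.toFun s 1‖) / (‖K.toFun t 0‖ * ‖K.toFun t 1‖)) := by
      linear_combination ((K.cuspSign t : ℝ) * (s - t)) * hst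
    rw [heq]
    exact mul_pos hs hfac
  · simp only [Φ, hf1, hinc]
    push_cast
    simp only [Prod.fst_add, Prod.snd_add]
    ring

end LegendrianKnot

end

end TorusFront

theorem proposition3p4 :
    Nonempty TorusFront.Parallelization ∧
      ∀ (P : TorusFront.Parallelization) (K : TorusFront.LegendrianKnot),
        K.InGeneralPosition → ∀ α β : ℤ, K.HasFrontClass α β →
          (∃ r : ℤ, K.HasRotation P r) ∧
            ∀ r : ℤ, K.HasRotation P r →
              (r : ℚ) = ((K.cuspPos : ℚ) - (K.cuspNeg : ℚ)) / 2 - α - β := by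
  refine ⟨⟨TorusFront.standardParallelization⟩, fun P K hK α β hab =>
    ⟨K.exists_hasRotation P, fun r hr => ?_⟩⟩
  have h := TorusFront.LegendrianKnot.two_mul_rotation_eq hr hK hab
  have h' : (2 * (r + α + β) : ℚ) = (K.cuspPos : ℚ) - K.cuspNeg := by exact_mod_cast h
  linarith
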